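/- Let $n\ge 1$, $\mathbb F=\mathbb Q(q,t)$, $\mathbb K=\mathbb Q(q,t,a)$ with $q,t,a$ indeterminates, and let $\iota$ be the field automorphism of $\mathbb K$ inverting $q$, $t$ and $a$, extended coefficientwise to $\mathbb K(x)=\mathbb K(x_1,\dots,x_n)$. For $v\in\mathbb Z^n$ let $\overline v\in\mathbb F^n$ be the point with $\overline v_i=q^{v_i}t^{-k_i(v)}$, where $k_i(v)=\#\{k<i: v_k\ge v_i\}+\#\{k>i: v_k>v_i\}$. For $\alpha\in\mathbb Z_{\ge0}^n$ with $|\alpha|=\alpha_1+\dots+\alpha_n$ let $G_\alpha\in\mathbb F[x]$ be the non-symmetric interpolation Macdonald polynomial, i.e. the unique polynomial of degree at most $|\alpha|$ whose coefficient of $x^\alpha$ is $1$ and with $G_\alpha(\overline\beta)=0$ for all $\beta\in\mathbb Z_{\ge0}^n$ with $|\beta|\le|\alpha|$, $\beta\ne\alpha$. Put $\tau=(1,t^{-1},\dots,t^{1-n})$ and $K_\alpha(x)=G_\alpha(x)/G_\alpha(a\tau)$. For $v\in\mathbb Z^n$ define $K_v\in\mathbb K(x)$ by $$K_v(x)=\Bigl(\prod_{i=1}^n\frac{(q^{1-m}a\overline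 v_i^{-1};q)_m}{(qt^{n-1}x_i;q)_m}\Bigr)K_{v+(m^n)}(q^mx),\qquad (y;q)_m=\prod_{j=0}^{m-1}(1-q^jy),$$ where $v+(m^n)=(v_1+m,\dots,v_n+m)$ and $m\ge0$ is the least integer such that $v+(m^n)\in\mathbb Z_{\ge0}^n$ (any other such $m$ gives the same function), and let $K_v^\circ=\iota(K_v)$. Let the symmetric group $S_n$ act on $\mathbb K(x)$ by permuting the variables, let $s_i$ be the transposition $(i,i+1)$, let $w_0$ be the longest element, $i\mapsto n+1-i$, of length $\ell(w_0)=n(n-1)/2$, and let $$H_i^\circ=t^{-1}+\frac{x_i-t^{-1}x_{i+1}}{x_i-x_{i+1}}(s_i-1)\quad(1\le i<n),\qquad H_{w_0}^\circ=H_{i_1}^\circ\cdots H_{i_\ell}^\circ$$ for a reduced expression $w_0=s_{i_1}\cdots s_{i_\ell}$ (the operator does not depend on it). Define $K_v'\in\mathbb K(x)$ for $v\in\mathbb Z^n$ by $$K_v'(x)=t^{\ell(w_0)}\,w_0H_{w_0}^\circ K_v^\circ(t^{n-1}x).$$ Then for all $u,v\in\mathbb Z^n$ the rational function $K_v'$ is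 regular at the point $a^{-1}\overline u$, $K_u'$ is regular at $a^{-1}\overline v$, and $$K_v'(a^{-1}\overline u)=K_u'(a^{-1}\overline v).$$ -/

import Mathlib

noncomputable section

namespace InterpMacdonald

/-! ### The coefficient fields `𝔽 = ℚ(q,t)` and `𝕂 = ℚ(q,t,a)`, and the automorphism `ι` -/

/-- Semilinear inversion of the variable: the ring endomorphism `f(X) ↦ f^σ(X⁻¹)` of `k[X]` into
`k(X)`, where `σ` is applied to the coefficients. -/
def invPoly {k : Type*} [Field k] (σ : k →+* k) : Polynomial k →+* RatFunc k :=
  Polynomial.eval₂RingHom ((algebraMap k (RatFunc k)).comp σ) (RatFunc.X)⁻¹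

theorem invPoly_injective {k : Type*} [Field k] (σ : k →+* k) :
    Function.Injective (invPoly σ) := by
  have hX : Transcendental k ((RatFunc.X : RatFunc k)⁻¹) := by
    intro h
    have h1 : IsAlgebraic k (RatFunc.X : RatFunc k) := by simpa using h.inv
    exact RatFunc.transcendental_X h1
  have h2 := transcendental_iff_injective.1 hX
  have h3 : ∀ p, invPoly σ p = Polynomial.aeval ((RatFunc.X : RatFunc k)⁻¹) (p.map σ) := by
    intro p
    simp [invPoly, Polynomial.aeval_def, Polynomial.eval₂_map]
  intro p p' hp
  rw [h3, h3] at hp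
  exact Polynomial.map_injective σ σ.injective (h2 hp)

/-- The endomorphism of the field `k(X)` that acts by `σ` on `k` and sends `X` to `X⁻¹`. -/
def invExt {k : Type*} [Field k] (σ : k →+* k) : RatFunc k →+* RatFunc k :=
  RatFunc.liftRingHom (invPoly σ)
    (nonZeroDivisors_le_comap_nonZeroDivisors_of_injective _ (invPoly_injective σ))

theorem invExt_algebraMap {k : Type*} [Field k] (σ : k →+* k) (c : k) :
    invExt σ (algebraMap k (RatFunc k) c) = algebraMap k (RatFunc k) (σ c) := by
  rw [IsScalarTower.algebraMap_apply k (Polynomial k) (RatFunc k)]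
  simp [invExt, invPoly]

theorem invExt_X {k : Type*} [Field k] (σ : k →+* k) :
    invExt σ (RatFunc.X : RatFunc k) = (RatFunc.X)⁻¹ := by
  rw [← RatFunc.algebraMap_X]
  simp [invExt, invPoly]

theorem invExt_invExt {k : Type*} [Field k] {σ : k →+* k} (hσ : ∀ c, σ (σ c) = c)
    (f : RatFunc k) : invExt σ (invExt σ f) = f := by
  have h : ∀ p : Polynomial k, invExt σ (invExt σ (algebraMap _ (RatFunc k) p)) =
      algebraMap _ (RatFunc k) p := by
    intro p
    induction p using Polynomial.induction_on' with
    | add p p' hp hp' => simp only [map_add, hp, hp']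
    | monomial m c =>
      rw [← Polynomial.C_mul_X_pow_eq_monomial]
      simp only [map_mul, map_pow, RatFunc.algebraMap_X, RatFunc.algebraMap_C, invExt_X,
        map_inv₀, inv_inv]
      rw [← RatFunc.algebraMap_eq_C, invExt_algebraMap, invExt_algebraMap, hσ]
  induction f using RatFunc.induction_on with
  | f p d hd => rw [map_div₀, map_div₀, h, h]

/-- `𝔽 = ℚ(q,t)`, as `ℚ(q)(t)`. -/
abbrev FF : Type := RatFunc (RatFunc ℚ)

/-- `𝕂 = ℚ(q,t,a)`, as `𝔽(a)`. -/
abbrev KK : Type := RatFunc FF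

def qF : FF := algebraMap (RatFunc ℚ) FF RatFunc.X
def tF : FF := RatFunc.X

theorem qF_ne_zero : qF ≠ 0 :=
  (map_ne_zero_iff _ (algebraMap (RatFunc ℚ) FF).injective).2 RatFunc.X_ne_zero

theorem tF_ne_zero : tF ≠ 0 := RatFunc.X_ne_zero

/-- The indeterminates `q`, `t`, `a` as units of `𝕂`. -/
def q : KKˣ := Units.mk0 (algebraMap FF KK qF)
  ((map_ne_zero_iff _ (algebraMap FF KK).injective).2 qF_ne_zero)
def t : KKˣ := Units.mk0 (algebraMap FF KK tF)
  ((map_ne_zero_iff _ (algebraMap FF KK).injective).2 tF_ne_zero)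
def a : KKˣ := Units.mk0 (RatFunc.X : KK) RatFunc.X_ne_zero

/-- The automorphism `ι` of `𝕂` inverting `q`, `t` and `a`. -/
def iota : KK →+* KK := invExt (invExt (invExt (RingHom.id ℚ)))

theorem iota_q : iota (q : KK) = (q : KK)⁻¹ := by
  simp only [iota, q, qF, Units.val_mk0, invExt_algebraMap, invExt_X, map_inv₀]

theorem iota_t : iota (t : KK) = (t : KK)⁻¹ := by
  simp only [iota, t, tF, Units.val_mk0, invExt_algebraMap, invExt_X, map_inv₀]

theorem iota_a : iota (a : KK) = (a : KK)⁻¹ := by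
  simp only [iota, a, Units.val_mk0, invExt_X]

theorem iota_iota (c : KK) : iota (iota c) = c :=
  invExt_invExt (invExt_invExt (invExt_invExt fun _ => rfl)) c

/-! ### Rational functions in `x₁, …, xₙ`, substitutions and values -/

/-- The field `k(x) = k(x₁,…,xₙ)`. -/
abbrev RatField (k : Type*) [Field k] (n : ℕ) : Type _ := FractionRing (MvPolynomial (Fin n) k)

section Rational

variable {k : Type*} [Field k] {n : ℕ}

/-- The variable `xᵢ` of `k(x)`. -/
def var (i : Fin n) : RatField k n :=
  algebraMap (MvPolynomial (Fin n) k) (RatField k n) (MvPolynomial.X i)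

/-- A permutation `w` of the indices acting on `k(x)` by the `k`-automorphism `xᵢ ↦ x_{w i}`. -/
def permAct (w : Equiv.Perm (Fin n)) : RatField k n →+* RatField k n :=
  IsFractionRing.map (A := MvPolynomial (Fin n) k)
    (j := (MvPolynomial.rename w : MvPolynomial (Fin n) k →ₐ[k] MvPolynomial (Fin n) k).toRingHom)
    (MvPolynomial.rename_injective w w.injective)

theorem permAct_var (w : Equiv.Perm (Fin n)) (i : Fin n) :
    permAct w (var i : RatField k n) = var (w i) := by
  simp [permAct, var, IsFractionRing.map]

theorem permAct_const (w : Equiv.Perm (Fin n)) (c : k) :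
    permAct w (algebraMap k (RatField k n) c) = algebraMap k (RatField k n) c := by
  rw [IsScalarTower.algebraMap_apply k (MvPolynomial (Fin n) k) (RatField k n)]
  simp [permAct, IsFractionRing.map, MvPolynomial.algebraMap_eq]

/-- `p(x) ↦ p(c x)` on polynomials. -/
def scalePoly (c : kˣ) : MvPolynomial (Fin n) k →ₐ[k] MvPolynomial (Fin n) k :=
  MvPolynomial.aeval fun i => MvPolynomial.C (c : k) * MvPolynomial.X i

theorem scalePoly_injective (c : kˣ) :
    Function.Injective (scalePoly c : MvPolynomial (Fin n) k →ₐ[k] MvPolynomial (Fin n) k) := by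
  have h : ((scalePoly c⁻¹).comp (scalePoly c) :
      MvPolynomial (Fin n) k →ₐ[k] MvPolynomial (Fin n) k) = AlgHom.id k _ := by
    ext1 i
    simp only [scalePoly, AlgHom.comp_apply, MvPolynomial.aeval_X, map_mul, AlgHom.id_apply,
      MvPolynomial.algHom_C, MvPolynomial.algebraMap_eq]
    rw [← mul_assoc, ← MvPolynomial.C_mul]
    simp
  intro p p' hp
  have := congrArg (scalePoly c⁻¹) hp
  rw [← AlgHom.comp_apply, ← AlgHom.comp_apply, h] at this
  simpa using this

/-- `f(x) ↦ f(c x) = f(c x₁, …, c xₙ)` on rational functions, for `c ≠ 0`. -/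
def scale (c : kˣ) : RatField k n →+* RatField k n :=
  IsFractionRing.map (A := MvPolynomial (Fin n) k)
    (j := (scalePoly c : MvPolynomial (Fin n) k →ₐ[k] MvPolynomial (Fin n) k).toRingHom)
    (scalePoly_injective c)

theorem scale_var (c : kˣ) (i : Fin n) :
    scale c (var i : RatField k n) = algebraMap k (RatField k n) c * var i := by
  rw [IsScalarTower.algebraMap_apply k (MvPolynomial (Fin n) k) (RatField k n)]
  simp [scale, var, IsFractionRing.map, scalePoly, MvPolynomial.algebraMap_eq]

/-- A field endomorphism `σ` of `k` acting on the coefficients of a rational function. -/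
def coeffAct (σ : k →+* k) : RatField k n →+* RatField k n :=
  IsFractionRing.map (A := MvPolynomial (Fin n) k) (j := MvPolynomial.map σ)
    (MvPolynomial.map_injective σ σ.injective)

theorem coeffAct_var (σ : k →+* k) (i : Fin n) :
    coeffAct σ (var i : RatField k n) = var i := by
  simp [coeffAct, var, IsFractionRing.map]

theorem coeffAct_const (σ : k →+* k) (c : k) :
    coeffAct σ (algebraMap k (RatField k n) c) = algebraMap k (RatField k n) (σ c) := by
  rw [IsScalarTower.algebraMap_apply k (MvPolynomial (Fin n) k) (RatField k n),
    IsScalarTower.algebraMap_apply k (MvPolynomial (Fin n) k) (RatField k n)]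
  simp [coeffAct, IsFractionRing.map, MvPolynomial.algebraMap_eq]

/-- `f` is regular at the point `y`: it is a quotient of polynomials whose denominator does not
vanish at `y`. -/
def IsRegularAt (f : RatField k n) (y : Fin n → k) : Prop :=
  ∃ p d : MvPolynomial (Fin n) k, MvPolynomial.eval y d ≠ 0 ∧
    f = algebraMap _ (RatField k n) p / algebraMap _ (RatField k n) d

open Classical in
/-- The value `f(y)` of a rational function at a point `y` at which it is regular. -/
def value (f : RatField k n) (y : Fin n → k) : k :=
  if h : IsRegularAt f y then
    MvPolynomial.eval y h.choose / MvPolynomial.eval y h.choose_spec.choose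
  else 0

theorem value_div (y : Fin n → k) (p d : MvPolynomial (Fin n) k)
    (hd : MvPolynomial.eval y d ≠ 0) :
    value (algebraMap _ (RatField k n) p / algebraMap _ (RatField k n) d) y =
      MvPolynomial.eval y p / MvPolynomial.eval y d := by
  have h : IsRegularAt (algebraMap _ (RatField k n) p / algebraMap _ (RatField k n) d) y :=
    ⟨p, d, hd, rfl⟩
  rw [value, dif_pos h]
  obtain ⟨h1, h2⟩ := h.choose_spec.choose_spec
  have hd0 : d ≠ 0 := by rintro rfl; simp at hd
  have hd1 : h.choose_spec.choose ≠ 0 := by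
    intro h0
    rw [h0] at h1
    simp at h1
  have inj := IsFractionRing.injective (MvPolynomial (Fin n) k) (RatField k n)
  rw [div_eq_div_iff ((map_ne_zero_iff _ inj).2 hd0) ((map_ne_zero_iff _ inj).2 hd1),
    ← map_mul, ← map_mul] at h2
  have h3 := congrArg (MvPolynomial.eval y) (inj h2)
  rw [map_mul, map_mul] at h3
  rw [div_eq_div_iff h1 hd]
  exact h3.symm

/-! ### The symmetric group and the Demazure–Lusztig operators -/

/-- The positions `i` and `i + 1` exchanged by the `i`-th simple transposition; there are
`n - 1` simple transpositions, numbered from `0`. -/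
def lft (i : Fin (n - 1)) : Fin n := ⟨i, by omega⟩
def rgt (i : Fin (n - 1)) : Fin n := ⟨i + 1, by omega⟩

/-- The simple transposition `sᵢ`. -/
def simple (i : Fin (n - 1)) : Equiv.Perm (Fin n) := Equiv.swap (lft i) (rgt i)

/-- The length `ℓ(w)` of a permutation: its number of inversions. -/
def len (w : Equiv.Perm (Fin n)) : ℕ :=
  (Finset.univ.filter fun p : Fin n × Fin n => p.1 < p.2 ∧ w p.2 < w p.1).card

/-- The Demazure–Lusztig operator
`Hᵢ = t + (xᵢ - t xᵢ₊₁) / (xᵢ - xᵢ₊₁) · (sᵢ - 1)` on `k(x)`, with parameter `t`. -/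
def heckeOp (t : k) (i : Fin (n - 1)) (f : RatField k n) : RatField k n :=
  algebraMap k (RatField k n) t * f +
    (var (lft i) - algebraMap k (RatField k n) t * var (rgt i)) / (var (lft i) - var (rgt i)) *
      (permAct (simple i) f - f)

/-- `H_{i₁} H_{i₂} ⋯ H_{iₗ} f` for a word `i₁ i₂ ⋯ iₗ`. -/
def heckeWord (t : k) (L : List (Fin (n - 1))) (f : RatField k n) : RatField k n :=
  L.foldr (heckeOp t) f

end Rational

/-- The word `s_{m-1} ⋯ s₁ s₀`. -/
def descWord (n : ℕ) : (m : ℕ) → m ≤ n - 1 → List (Fin (n - 1))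
  | 0, _ => []
  | m + 1, h => ⟨m, h⟩ :: descWord n m (Nat.le_of_succ_le h)

/-- The word `(s₀)(s₁ s₀)(s₂ s₁ s₀) ⋯ (s_{m-1} ⋯ s₁ s₀)`. -/
def stairWord (n : ℕ) : (m : ℕ) → m ≤ n - 1 → List (Fin (n - 1))
  | 0, _ => []
  | m + 1, h => stairWord n m (Nat.le_of_succ_le h) ++ descWord n (m + 1) h

/-- The reduced word `(s₀)(s₁ s₀) ⋯ (s_{n-2} ⋯ s₁ s₀)` of the longest permutation `w₀`. -/
def longWord (n : ℕ) : List (Fin (n - 1)) := stairWord n (n - 1) le_rfl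

/-- The longest permutation `w₀`, which reverses the order of the indices. -/
def w0 (n : ℕ) : Equiv.Perm (Fin n) := Fin.revPerm

theorem simple_val {n : ℕ} (i : Fin (n - 1)) (j : Fin n) :
    ((simple i j : Fin n) : ℕ) =
      if (j : ℕ) = i then (i : ℕ) + 1 else if (j : ℕ) = i + 1 then (i : ℕ) else j := by
  simp only [simple, Equiv.swap_apply_def, lft, rgt, Fin.ext_iff]
  split_ifs <;> rfl

theorem descWord_val {n : ℕ} (m : ℕ) (h : m ≤ n - 1) (j : Fin n) :
    ((((descWord n m h).map simple).prod j : Fin n) : ℕ) =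
      if (j : ℕ) = 0 then m else if (j : ℕ) ≤ m then (j : ℕ) - 1 else j := by
  induction m with
  | zero =>
    simp only [descWord, List.map_nil, List.prod_nil, Equiv.Perm.coe_one, id]
    split_ifs <;> omega
  | succ m ih =>
    simp only [descWord, List.map_cons, List.prod_cons, Equiv.Perm.mul_apply, simple_val, ih]
    split_ifs <;> omega

theorem stairWord_val {n : ℕ} (m : ℕ) (h : m ≤ n - 1) (j : Fin n) :
    ((((stairWord n m h).map simple).prod j : Fin n) : ℕ) =
      if (j : ℕ) ≤ m then m - (j : ℕ) else j := by
  induction m generalizing j with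
  | zero =>
    simp only [stairWord, List.map_nil, List.prod_nil, Equiv.Perm.coe_one, id]
    split_ifs <;> omega
  | succ m ih =>
    simp only [stairWord, List.map_append, List.prod_append, Equiv.Perm.mul_apply, ih,
      descWord_val]
    split_ifs <;> omega

/-- `longWord` is an expression of `w₀` as a product of simple transpositions. -/
theorem longWord_prod (n : ℕ) : ((longWord n).map simple).prod = w0 n := by
  ext j
  have := j.isLt
  rw [longWord, stairWord_val, w0, Fin.revPerm_apply, Fin.val_rev]
  split_ifs <;> omega

/-- This expression of `w₀` is reduced. -/
theorem longWord_length (n : ℕ) : (longWord n).length = len (w0 n) := by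
  have h1 : ∀ m h, (descWord n m h).length = m := by
    intro m
    induction m with
    | zero => intro h; rfl
    | succ m ih => intro h; simp [descWord, ih]
  have h2 : ∀ m h, (stairWord n m h).length = ∑ i ∈ Finset.range (m + 1), i := by
    intro m
    induction m with
    | zero => intro h; rfl
    | succ m ih => intro h; rw [Finset.sum_range_succ]; simp [stairWord, ih, h1]
  have h3 : len (w0 n) = ∑ j : Fin n, (j : ℕ) := by
    have : ∀ j : Fin n, (j : ℕ) =
        (Finset.univ.filter fun p : Fin n × Fin n => (p.1 < p.2 ∧ w0 n p.2 < w0 n p.1) ∧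
          p.2 = j).card := by
      intro j
      have h4 : (Finset.univ.filter fun p : Fin n × Fin n =>
          (p.1 < p.2 ∧ w0 n p.2 < w0 n p.1) ∧ p.2 = j) =
          (Finset.Iio j).map ⟨fun i => (i, j), fun x y h => by simpa using h⟩ := by
        ext ⟨x, y⟩
        simp only [w0, Fin.revPerm_apply, Fin.rev_lt_rev, Finset.mem_filter, Finset.mem_univ,
          true_and, Finset.mem_map, Finset.mem_Iio]
        constructor
        · rintro ⟨⟨h, -⟩, rfl⟩
          exact ⟨x, h, rfl⟩
        · rintro ⟨i, h, h'⟩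
          obtain ⟨rfl, rfl⟩ := Prod.mk.inj h'
          exact ⟨⟨h, h⟩, rfl⟩
      rw [h4, Finset.card_map, Fin.card_Iio]
    rw [Finset.sum_congr rfl fun j _ => this j, len]
    rw [Finset.card_eq_sum_card_fiberwise (f := Prod.snd) (t := Finset.univ)
      (fun x _ => Finset.mem_univ _)]
    simp only [Finset.filter_filter]
  rw [h3, longWord, h2, Fin.sum_univ_eq_sum_range (fun i => i) n]
  rcases n with _ | n <;> rfl

/-- `H_{w₀}`, with parameter `t`. -/
def heckeLong {k : Type*} [Field k] {n : ℕ} (t : k) (f : RatField k n) : RatField k n :=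
  heckeWord t (longWord n) f

/-! ### Interpolation polynomials -/

section Points

variable {k : Type*} [Field k] {n : ℕ}

/-- `kᵢ(v) = #{j < i | v_j ≥ v_i} + #{j > i | v_j > v_i}`. -/
def rank (v : Fin n → ℤ) (i : Fin n) : ℕ :=
  (Finset.univ.filter fun j => j < i ∧ v i ≤ v j).card +
    (Finset.univ.filter fun j => i < j ∧ v i < v j).card

/-- The spectral point `v̄ = (q^{v_i} t^{-k_i(v)})_i`. -/
def bar (q t : k) (v : Fin n → ℤ) : Fin n → k :=
  fun i => q ^ v i * t ^ (-(rank v i : ℤ))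

/-- The defining properties of the non-symmetric interpolation Macdonald polynomial of degree
`α`: degree at most `|α|`, vanishing at `β̄` for all compositions `β ≠ α` with `|β| ≤ |α|`, and
coefficient `1` at `x^α`. -/
structure IsInterpolation (q t : k) (α : Fin n → ℕ) (G : MvPolynomial (Fin n) k) : Prop where
  totalDegree_le : G.totalDegree ≤ ∑ i, α i
  vanishing : ∀ β : Fin n → ℕ, ∑ i, β i ≤ ∑ i, α i → β ≠ α →
    MvPolynomial.eval (bar q t fun i => (β i : ℤ)) G = 0
  coeff_eq_one : MvPolynomial.coeff (Finsupp.equivFunOnFinite.symm α) G = 1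

/-- The `q`-shifted factorial `(y; q)_m = ∏_{j < m} (1 - q^j y)`. -/
def qPoch {A : Type*} [CommRing A] (q y : A) (m : ℕ) : A :=
  ∏ j ∈ Finset.range m, (1 - q ^ j * y)

end Points

variable {n : ℕ}

/-- The non-symmetric interpolation Macdonald polynomial `G_α ∈ 𝔽[x]`: the unique polynomial
with the properties `IsInterpolation`. -/
def G (α : Fin n → ℕ) : MvPolynomial (Fin n) FF :=
  Classical.epsilon (IsInterpolation qF tF α)

/-- `G_α` as an element of `𝕂[x]`. -/
def GK (α : Fin n → ℕ) : MvPolynomial (Fin n) KK :=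
  MvPolynomial.map (algebraMap FF KK) (G α)

/-- The point `τ = (1, t⁻¹, …, t^{1-n})`. -/
def tau : Fin n → KK := fun i => (t : KK) ^ (-((i : ℕ) : ℤ))

/-- `K_α(x) = G_α(x) / G_α(aτ) ∈ 𝕂[x]` for a composition `α`. -/
def Kpol (α : Fin n → ℕ) : MvPolynomial (Fin n) KK :=
  MvPolynomial.C (MvPolynomial.eval (fun i => (a : KK) * tau i) (GK α))⁻¹ * GK α

/-- `A_m(x; v) = ∏ᵢ (q^{1-m} a v̄ᵢ⁻¹; q)_m / (q t^{n-1} xᵢ; q)_m`. -/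
def Afactor (m : ℕ) (v : Fin n → ℤ) : RatField KK n :=
  ∏ i, algebraMap KK (RatField KK n)
      (qPoch (q : KK) ((q : KK) ^ (1 - (m : ℤ)) * a * (bar (q : KK) t v i)⁻¹) m) /
    qPoch (algebraMap KK (RatField KK n) q)
      (algebraMap KK (RatField KK n) ((q : KK) * (t : KK) ^ ((n : ℤ) - 1)) * var i) m

/-- The least `m ≥ 0` such that `v + (mⁿ)` is a composition. -/
def shift (v : Fin n → ℤ) : ℕ := Finset.univ.sup fun i => (-v i).toNat

theorem shift_nonneg (v : Fin n → ℤ) (i : Fin n) : 0 ≤ v i + shift v := by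
  have : (-v i).toNat ≤ shift v :=
    Finset.le_sup (f := fun i => (-v i).toNat) (Finset.mem_univ i)
  omega

/-- `K_v(x) = A_m(x; v) K_{v + (mⁿ)}(q^m x) ∈ 𝕂(x)` for `v ∈ ℤⁿ`, where `m ≥ 0` is such that
`v + (mⁿ)` is a composition (the least such `m` is taken; the result does not depend on it). -/
def K (v : Fin n → ℤ) : RatField KK n :=
  Afactor (shift v) v *
    scale (q ^ shift v) (algebraMap _ (RatField KK n)
      (Kpol fun i => (v i + shift v).toNat))

/-- `K_v° = ι(K_v)`. -/
def Kcirc (v : Fin n → ℤ) : RatField KK n := coeffAct iota (K v)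

/-- `Ψ = w₀ H°_{w₀}`, where `H°` is `H` with `t` replaced by `t⁻¹`. -/
def Psi (f : RatField KK n) : RatField KK n :=
  permAct (w0 n) (heckeLong (t : KK)⁻¹ f)

/-- `K'_v(x) = t^{ℓ(w₀)} Ψ K_v°(t^{n-1} x)`. -/
def Kprime (v : Fin n → ℤ) : RatField KK n :=
  algebraMap KK (RatField KK n) ((t : KK) ^ len (w0 n)) *
    Psi (scale (t ^ ((n : ℤ) - 1)) (Kcirc v))

/-- The point `a⁻¹ v̄`. -/
def ainvBar (v : Fin n → ℤ) : Fin n → KK := fun i => (a : KK)⁻¹ * bar (q : KK) t v i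

end InterpMacdonald

end

/-! The matrix of monomials of degree at most `d` at the spectral points is nonsingular for generic
`q` and `t`, so `G_α` exists and is unique. Uniqueness identifies what the operators do to `G_α`:
`H_i G_α` is a combination of `G_α` and `G_{s_i α}`, and the raising operator yields `G_{cyc α}`,
where `cyc α = (α₂, …, αₙ, α₁ + 1)`. Their composite, the inhomogeneous Cherednik operator, has
`G_α` as an eigenfunction; evaluated at `b (1, t⁻¹, …, t^{1-n})`, the eigenvalue equation gives the
ratio of the normalising factors of `G_{cyc α}` and `G_α`. Thus `K_v` obeys explicit recursions in
`v` under the `s_i` and `cyc`. With `ũ` the spectral point of `-w₀u`, the function `K_v(aũ)` obeys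
the same recursions in `u`, whence the duality `K_u(aṽ) = K_v(aũ)`.

Put `S(v, u) = ι(K_v(aũ))`, a symmetric function. In `v` the operator of `s_i` acts on `S` as the
operator of `s_{n-i}` does in `u`. The values of `K'_v` at `a⁻¹ū` arise from `S` by applying a
reduced word of `w₀` in the variable `u`. Operators in different variables commute, so moving the
word over to `v` reverses it and mirrors its letters; the result is again a reduced word of `w₀`,
and by the braid relations the operator is unchanged. Hence `K'_v(a⁻¹ū)` is symmetric as well. -/

noncomputable section

namespace InterpMacdonald

open MvPolynomial

/-! ### Ranks and spectral points -/

section Rank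

variable {n : ℕ}

/-- The key by which `rank` orders the indices: decreasing entries first, ties broken from left
to right. -/
def sortKey (v : Fin n → ℤ) (i : Fin n) : ℤᵒᵈ ×ₗ Fin n := toLex (OrderDual.toDual (v i), i)

theorem sortKey_lt_iff {v : Fin n → ℤ} {i j : Fin n} :
    sortKey v j < sortKey v i ↔ v i < v j ∨ v i = v j ∧ j < i := by
  simp [sortKey, Prod.Lex.toLex_lt_toLex, eq_comm]

theorem sortKey_injective (v : Fin n → ℤ) : Function.Injective (sortKey v) := fun _ _ h =>
  congrArg (fun x => (ofLex x).2) h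

theorem rank_eq_card (v : Fin n → ℤ) (i : Fin n) :
    rank v i = (Finset.univ.filter fun j => sortKey v j < sortKey v i).card := by
  have hdisj : Disjoint (Finset.univ.filter fun j => j < i ∧ v i ≤ v j)
      (Finset.univ.filter fun j => i < j ∧ v i < v j) :=
    Finset.disjoint_filter.2 fun j _ h h' => h.1.not_gt h'.1
  rw [rank, ← Finset.card_union_of_disjoint hdisj, ← Finset.filter_or]
  congr 1
  ext j
  simp only [Finset.mem_filter, Finset.mem_univ, true_and, sortKey_lt_iff]
  grind

theorem rank_comp_perm {v w : Fin n → ℤ} (σ : Equiv.Perm (Fin n))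
    (h : ∀ j i, sortKey w j < sortKey w i ↔ sortKey v (σ j) < sortKey v (σ i)) (i : Fin n) :
    rank w i = rank v (σ i) := by
  rw [rank_eq_card, rank_eq_card]
  exact Finset.card_equiv σ fun j => by simp [h]

theorem rank_lt_rank {v : Fin n → ℤ} {i j : Fin n} (h : sortKey v j < sortKey v i) :
    rank v j < rank v i := by
  rw [rank_eq_card, rank_eq_card]
  refine Finset.card_lt_card (Finset.ssubset_iff.2 ⟨j, by simp, fun l hl => ?_⟩)
  rcases Finset.mem_insert.1 hl with rfl | hl
  · simpa using h
  · simpa using (Finset.mem_filter.1 hl).2.trans h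

theorem rank_injective (v : Fin n → ℤ) : Function.Injective (rank v) := by
  intro i j h
  by_contra hne
  rcases lt_or_gt_of_ne ((sortKey_injective v).ne hne) with hlt | hlt
  · exact (rank_lt_rank hlt).ne h
  · exact (rank_lt_rank hlt).ne' h

theorem rank_neg_rev (v : Fin n → ℤ) (i : Fin n) :
    rank (fun j => -v j.rev) i + rank v i.rev + 1 = n := by
  have hneg : rank (fun j => -v j.rev) i =
      (Finset.univ.filter fun j => sortKey v i.rev < sortKey v j).card := by
    rw [rank_eq_card]
    exact Finset.card_equiv Fin.revPerm fun j => by simp [sortKey_lt_iff, eq_comm]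
  have hle : (Finset.univ.filter fun j => ¬ sortKey v j < sortKey v i.rev) =
      insert i.rev (Finset.univ.filter fun j => sortKey v i.rev < sortKey v j) := by
    ext j
    simp [le_iff_eq_or_lt, (sortKey_injective v).eq_iff, eq_comm]
  have hcard := Finset.card_filter_add_card_filter_not (s := (Finset.univ : Finset (Fin n)))
    fun j => sortKey v j < sortKey v i.rev
  rw [hle, Finset.card_insert_of_notMem (by simp), Finset.card_univ, Fintype.card_fin] at hcard
  rw [hneg, rank_eq_card]
  omega

theorem rank_add_const (v : Fin n → ℤ) (c : ℤ) (i : Fin n) :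
    rank (fun j => v j + c) i = rank v i :=
  rank_comp_perm 1 (by simp [sortKey_lt_iff]) i

theorem rank_comp_swap (v : Fin n → ℤ) {i j : Fin n} (hij : (j : ℕ) = i + 1)
    (hv : v i ≠ v j) (l : Fin n) :
    rank (v ∘ Equiv.swap i j) l = rank v (Equiv.swap i j l) := by
  refine rank_comp_perm (Equiv.swap i j) (fun x y => ?_) l
  have tie : v (Equiv.swap i j y) = v (Equiv.swap i j x) →
      (x < y ↔ Equiv.swap i j x < Equiv.swap i j y) := by
    intro h
    simp only [Equiv.swap_apply_def] at h ⊢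
    split_ifs at h ⊢ <;> simp_all only [Fin.lt_def, Fin.ext_iff] <;> omega
  simp only [sortKey_lt_iff]
  exact or_congr_right (and_congr_right tie)

theorem rank_succ_of_eq (v : Fin n → ℤ) {i j : Fin n} (hij : (j : ℕ) = i + 1)
    (hv : v i = v j) : rank v j = rank v i + 1 := by
  have hcons : (Finset.univ.filter fun l => sortKey v l < sortKey v j) =
      insert i (Finset.univ.filter fun l => sortKey v l < sortKey v i) := by
    ext l
    simp only [Finset.mem_insert, Finset.mem_filter, Finset.mem_univ, true_and, sortKey_lt_iff,
      Fin.lt_def, Fin.ext_iff]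
    grind
  rw [rank_eq_card, rank_eq_card, hcons, Finset.card_insert_of_notMem (by simp)]

/-- The cyclic raising of compositions, `(v₁, …, vₙ) ↦ (v₂, …, vₙ, v₁ + 1)`: the step that,
together with the simple transpositions, reaches every composition from `0`. -/
def cyc {N : ℕ} {A : Type*} [Add A] [One A] (v : Fin (N + 1) → A) : Fin (N + 1) → A :=
  Fin.snoc (fun i : Fin N => v i.succ) (v 0 + 1)

theorem cyc_last {N : ℕ} {A : Type*} [Add A] [One A] (v : Fin (N + 1) → A) :
    cyc v (Fin.last N) = v 0 + 1 := by simp [cyc]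

theorem cyc_castSucc {N : ℕ} {A : Type*} [Add A] [One A] (v : Fin (N + 1) → A) (i : Fin N) :
    cyc v i.castSucc = v i.succ := by simp [cyc]

theorem rank_cyc {N : ℕ} (v : Fin (N + 1) → ℤ) (i : Fin (N + 1)) :
    rank (cyc v) i = rank v (finRotate (N + 1) i) := by
  refine rank_comp_perm (finRotate (N + 1)) (fun j i => ?_) i
  induction i using Fin.lastCases with
  | last =>
    induction j using Fin.lastCases with
    | last => simp
    | cast j =>
      have hrot : finRotate (N + 1) j.castSucc = j.succ := by simp
      simp only [hrot, finRotate_last, sortKey_lt_iff, cyc_last, cyc_castSucc,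
        Fin.castSucc_lt_last, Fin.not_lt_zero, and_true, and_false, or_false]
      omega
  | cast i =>
    induction j using Fin.lastCases with
    | last =>
      simp [sortKey_lt_iff, cyc_last, cyc_castSucc, Fin.succ_pos, le_iff_lt_or_eq,
        (Fin.castSucc_lt_last i).not_gt]
    | cast j => simp [sortKey_lt_iff, cyc_castSucc]

theorem rank_last_of_nonneg {N : ℕ} (v : Fin (N + 1) → ℤ) (h : ∀ i, 0 ≤ v i)
    (hlast : v (Fin.last N) = 0) : rank v (Fin.last N) = N := by
  have hall : (Finset.univ.filter fun j => sortKey v j < sortKey v (Fin.last N)) =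
      Finset.univ.erase (Fin.last N) := by
    ext j
    have hj := h j
    simp only [Finset.mem_filter, Finset.mem_univ, true_and, Finset.mem_erase, and_true,
      sortKey_lt_iff, hlast, Fin.lt_last_iff_ne_last]
    grind
  rw [rank_eq_card, hall]
  simp

end Rank

section Bar

variable {k : Type*} [Field k] {q t : k} {n : ℕ}

theorem bar_ne_zero (hq : q ≠ 0) (ht : t ≠ 0) (v : Fin n → ℤ) (i : Fin n) : bar q t v i ≠ 0 :=
  mul_ne_zero (zpow_ne_zero _ hq) (zpow_ne_zero _ ht)

theorem bar_add_const (hq : q ≠ 0) (v : Fin n → ℤ) (c : ℤ) (i : Fin n) :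
    bar q t (fun j => v j + c) i = q ^ c * bar q t v i := by
  rw [bar, bar, rank_add_const, zpow_add₀ hq]
  ring

theorem bar_comp_swap (v : Fin n → ℤ) {i j : Fin n} (hij : (j : ℕ) = i + 1) (hv : v i ≠ v j) :
    bar q t (v ∘ Equiv.swap i j) = bar q t v ∘ Equiv.swap i j := by
  ext l
  rw [Function.comp_apply, bar, bar, rank_comp_swap v hij hv, Function.comp_apply]

theorem bar_of_eq (ht : t ≠ 0) (v : Fin n → ℤ) {i j : Fin n} (hij : (j : ℕ) = i + 1)
    (hv : v i = v j) : bar q t v i = t * bar q t v j := by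
  rw [bar, bar, rank_succ_of_eq v hij hv, hv, mul_left_comm, ← zpow_one_add₀ ht]
  congr 2
  push_cast
  ring

theorem bar_neg_rev (ht : t ≠ 0) (v : Fin n → ℤ) (i : Fin n) :
    bar q t (fun j => -v j.rev) i = t ^ (1 - (n : ℤ)) * (bar q t v i.rev)⁻¹ := by
  have hrank := rank_neg_rev v i
  rw [bar, bar, mul_inv, ← zpow_neg, ← zpow_neg, mul_left_comm, ← zpow_add₀ ht]
  congr 2
  omega

theorem bar_cyc_last (hq : q ≠ 0) {N : ℕ} (v : Fin (N + 1) → ℤ) :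
    bar q t (cyc v) (Fin.last N) = q * bar q t v 0 := by
  rw [bar, bar, rank_cyc, cyc_last, finRotate_last, zpow_add₀ hq, zpow_one]
  ring

theorem bar_cyc_castSucc {N : ℕ} (v : Fin (N + 1) → ℤ) (i : Fin N) :
    bar q t (cyc v) i.castSucc = bar q t v i.succ := by
  rw [bar, bar, rank_cyc, cyc_castSucc]
  simp

theorem bar_last_of_nonneg {N : ℕ} (v : Fin (N + 1) → ℤ) (h : ∀ i, 0 ≤ v i)
    (hlast : v (Fin.last N) = 0) : bar q t v (Fin.last N) = t ^ (-(N : ℤ)) := by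
  rw [bar, rank_last_of_nonneg v h hlast, hlast]
  simp

end Bar

/-! ### Genericity and interpolation -/

section Genericity

variable {k : Type*} [Field k] {q t : k} {n : ℕ}

/-- The parameters `q` and `t` are indeterminates: algebraically independent over `ℤ`, which
forces characteristic zero. -/
def Generic {k : Type*} [Field k] (q t : k) : Prop := AlgebraicIndependent ℤ ![q, t]

theorem generic_of_transcendental {F K : Type*} [CharZero k] [Field F] [Field K] [Algebra k F]
    [Algebra F K] {x : F} {y : K} (hx : Transcendental k x) (hy : Transcendental F y) :
    Generic (algebraMap F K x) y := by
  have hx' : AlgebraicIndependent ℤ ![x] :=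
    (algebraicIndependent_iff_transcendental.2 hx).restrictScalars (algebraMap ℤ k).injective_int
  have hy' : AlgebraicIndependent F ![y] := algebraicIndependent_iff_transcendental.2 hy
  unfold Generic
  convert (hx'.sumElim_comp hy').comp ![Sum.inr 0, Sum.inl 0] (by decide) using 1
  ext i
  fin_cases i <;> rfl

theorem Generic.map {K : Type*} [Field K] (h : Generic q t) (f : k →+* K) :
    Generic (f q) (f t) := by
  unfold Generic
  convert AlgebraicIndependent.map' h (f := f.toIntAlgHom) f.injective using 1
  ext i
  fin_cases i <;> rfl

theorem Generic.infinite (h : Generic q t) : Infinite k :=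
  Infinite.of_injective _ (AlgebraicIndependent.algebraMap_injective h)

theorem Generic.q_ne_zero (h : Generic q t) : q ≠ 0 := AlgebraicIndependent.ne_zero h 0

theorem Generic.t_ne_zero (h : Generic q t) : t ≠ 0 := AlgebraicIndependent.ne_zero h 1

theorem Generic.pow_mul_pow_inj (h : Generic q t) {a b c d : ℕ}
    (e : q ^ a * t ^ b = q ^ c * t ^ d) : a = c ∧ b = d := by
  have hX : (X 0 ^ a * X 1 ^ b : MvPolynomial (Fin 2) ℤ) = X 0 ^ c * X 1 ^ d :=
    h (by simpa using e)
  have ha : (2 : ℤ) ^ a = 2 ^ c := by simpa using congrArg (eval ![2, 1]) hX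
  have hb : (2 : ℤ) ^ b = 2 ^ d := by simpa using congrArg (eval ![1, 2]) hX
  exact ⟨Int.pow_right_injective (by norm_num) ha, Int.pow_right_injective (by norm_num) hb⟩

theorem Generic.zpow_mul_zpow_eq_one (h : Generic q t) {a b : ℤ} (e : q ^ a * t ^ b = 1) :
    a = 0 ∧ b = 0 := by
  have hsplit : q ^ a.toNat * t ^ b.toNat = q ^ (-a).toNat * t ^ (-b).toNat := by
    have hq := pow_ne_zero (-a).toNat h.q_ne_zero
    have ht := pow_ne_zero (-b).toNat h.t_ne_zero
    rw [← Int.toNat_sub_toNat_neg a, ← Int.toNat_sub_toNat_neg b, zpow_sub₀ h.q_ne_zero,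
      zpow_sub₀ h.t_ne_zero] at e
    simp only [zpow_natCast] at e
    field_simp at e
    exact e
  have := h.pow_mul_pow_inj hsplit
  omega

theorem Generic.zpow_mul_zpow_inj (h : Generic q t) {a b c d : ℤ}
    (e : q ^ a * t ^ b = q ^ c * t ^ d) : a = c ∧ b = d := by
  have hdiff : q ^ (a - c) * t ^ (b - d) = 1 := by
    rw [zpow_sub₀ h.q_ne_zero, zpow_sub₀ h.t_ne_zero, div_mul_div_comm, e]
    exact div_self (mul_ne_zero (zpow_ne_zero _ h.q_ne_zero) (zpow_ne_zero _ h.t_ne_zero))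
  have := h.zpow_mul_zpow_eq_one hdiff
  omega

theorem Generic.t_ne_one (h : Generic q t) : t ≠ 1 := by
  intro e
  have := h.zpow_mul_zpow_eq_one (a := 0) (b := 1) (by simp [e])
  omega

theorem Generic.bar_injective (h : Generic q t) (v : Fin n → ℤ) :
    Function.Injective (bar q t v) := by
  intro i j e
  have := (h.zpow_mul_zpow_inj e).2
  exact rank_injective v (by omega)

theorem Generic.eq_of_bar_eq_mul (h : Generic q t) {v : Fin n → ℤ} {i j : Fin n}
    (e : bar q t v i = t * bar q t v j) : v i = v j := by
  rw [bar, bar, mul_left_comm, ← zpow_one_add₀ h.t_ne_zero] at e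
  exact (h.zpow_mul_zpow_inj e).1

end Genericity

section Interpolation

variable {k : Type*} [Field k] {q t : k} {n : ℕ}

/-- The spectral point `ᾱ` of a composition `α`. -/
abbrev node (q t : k) (α : Fin n → ℕ) : Fin n → k := bar q t fun i => (α i : ℤ)

theorem map_node {K : Type*} [Field K] (f : k →+* K) (α : Fin n → ℕ) (i : Fin n) :
    f (node q t α i) = node (f q) (f t) α i := by
  simp [bar]

theorem sum_mul_comp_perm_lt {ι κ : Type*} [Fintype ι] [Fintype κ] {x : ι → κ → ℕ}
    (hx : Function.Injective x) {σ : Equiv.Perm ι} (hσ : σ ≠ 1) :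
    ∑ b, ∑ i, x (σ b) i * x b i < ∑ b, ∑ i, x b i * x b i := by
  have hpos : 0 < ∑ b, ∑ i, ((x (σ b) i : ℤ) - x b i) ^ 2 := by
    obtain ⟨b, hb⟩ : ∃ b, σ b ≠ b := not_forall.1 fun h => hσ (Equiv.ext h)
    obtain ⟨i, hi⟩ : ∃ i, x (σ b) i ≠ x b i := Function.ne_iff.1 (hx.ne hb)
    have : (x (σ b) i : ℤ) - x b i ≠ 0 := by omega
    exact Finset.sum_pos' (fun b _ => Finset.sum_nonneg fun i _ => sq_nonneg _)
      ⟨b, Finset.mem_univ _, Finset.sum_pos' (fun i _ => sq_nonneg _)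
        ⟨i, Finset.mem_univ _, by positivity⟩⟩
  have hperm : ∑ b, ∑ i, (x (σ b) i : ℤ) ^ 2 = ∑ b, ∑ i, (x b i : ℤ) ^ 2 :=
    Equiv.sum_comp σ fun b => ∑ i, (x b i : ℤ) ^ 2
  simp only [sub_sq, Finset.sum_add_distrib, Finset.sum_sub_distrib, hperm, mul_assoc,
    ← Finset.mul_sum] at hpos
  zify
  simp only [← sq]
  linarith

theorem det_X_pow_ne_zero {ι κ : Type*} [Fintype ι] [DecidableEq ι] [Fintype κ] {x : ι → κ → ℕ}
    (hx : Function.Injective x) :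
    (Matrix.of fun b c => (Polynomial.X : Polynomial ℤ) ^ (∑ i, x b i * x c i)).det ≠ 0 := by
  intro h
  have hcoeff := congrArg (fun p => p.coeff (∑ b, ∑ i, x b i * x b i)) h
  simp only [Matrix.det_apply, Matrix.of_apply, Finset.prod_pow_eq_pow_sum,
    Polynomial.finsetSum_coeff, Polynomial.coeff_zero, Polynomial.coeff_smul,
    Polynomial.coeff_X_pow] at hcoeff
  rw [Finset.sum_eq_single 1 _ (by simp)] at hcoeff
  · simp at hcoeff
  · intro σ _ hσ
    rw [if_neg (sum_mul_comp_perm_lt hx hσ).ne', smul_zero]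

/-- The matrix of values of the monomials with exponents `x c` at the spectral points of the
`x b`. -/
def spectralMatrix {ι : Type*} (q t : k) (x : ι → Fin n →₀ ℕ) : Matrix ι ι k :=
  Matrix.of fun b c => ∏ i, node q t (x b) i ^ x c i

theorem spectralMatrix_mulVec {ι : Type*} [Fintype ι] (x : ι → Fin n →₀ ℕ) (f : ι → k) (b : ι) :
    (spectralMatrix q t x).mulVec f b =
      eval (node q t (x b)) (∑ c, monomial (x c) (f c)) := by
  simp only [spectralMatrix, Matrix.mulVec, dotProduct, Matrix.of_apply, map_sum, eval_monomial,
    Finsupp.prod_fintype _ _ fun _ => pow_zero _, mul_comm]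

/-- The matrix is specialised at `t = 1`, where the top power of `q` in the determinant comes from
the identity permutation alone, by the rearrangement inequality. -/
theorem Generic.det_spectralMatrix_ne_zero (h : Generic q t) {ι : Type*} [Fintype ι]
    [DecidableEq ι] {x : ι → Fin n →₀ ℕ} (hx : Function.Injective x) :
    (spectralMatrix q t x).det ≠ 0 := by
  let M : Matrix ι ι (MvPolynomial (Fin 2) ℤ) := Matrix.of fun b c =>
    ∏ i, (X 0 ^ x b i * X 1 ^ (n - rank (fun i => (x b i : ℤ)) i)) ^ x c i
  have hM : M.det ≠ 0 := by
    intro hzero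
    refine det_X_pow_ne_zero (x := fun b i => x b i) (DFunLike.coe_injective.comp hx) ?_
    rw [← map_zero (aeval ![Polynomial.X, 1] : MvPolynomial (Fin 2) ℤ →ₐ[ℤ] Polynomial ℤ),
      ← hzero, AlgHom.map_det]
    congr 1
    ext1 b c
    simp [M, ← pow_mul, Finset.prod_pow_eq_pow_sum]
  have hrank : ∀ v : Fin n → ℤ, ∀ i, rank v i ≤ n := fun v i => by
    rw [rank_eq_card]
    exact (Finset.card_le_univ _).trans (by simp)
  have hspec : (aeval ![q, t] : MvPolynomial (Fin 2) ℤ →ₐ[ℤ] k).mapMatrix M =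
      Matrix.of fun b c => (∏ i, (t ^ n) ^ x c i) * spectralMatrix q t x b c := by
    ext1 b c
    simp only [M, spectralMatrix, AlgHom.mapMatrix_apply, Matrix.map_apply, Matrix.of_apply,
      map_prod, map_pow, map_mul, aeval_X, ← Finset.prod_mul_distrib, ← mul_pow, bar,
      zpow_natCast, zpow_neg, Matrix.cons_val_zero, Matrix.cons_val_one,
      pow_sub₀ t h.t_ne_zero (hrank _ _)]
    exact Finset.prod_congr rfl fun i _ => by ring
  intro hzero
  have hdet := congrArg Matrix.det hspec
  rw [← AlgHom.map_det, Matrix.det_mul_row, hzero, mul_zero] at hdet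
  exact hM (h (hdet.trans (map_zero _).symm))

theorem Generic.exists_eval_node_eq (h : Generic q t) (S : Finset (Fin n →₀ ℕ))
    (f : (Fin n →₀ ℕ) → k) :
    ∃ p ∈ restrictSupport k (S : Set (Fin n →₀ ℕ)), ∀ β ∈ S, eval (node q t β) p = f β := by
  classical
  have hdet := h.det_spectralMatrix_ne_zero (Subtype.val_injective (p := (· ∈ S)))
  obtain ⟨c, hc⟩ := Matrix.mulVec_surjective_iff_isUnit.2
    ((Matrix.isUnit_iff_isUnit_det _).2 hdet.isUnit) fun b : S => f b
  refine ⟨∑ b : S, monomial (b : Fin n →₀ ℕ) (c b), ?_, fun β hβ => ?_⟩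
  · exact Submodule.sum_mem _ fun b _ => (monomial_mem_restrictSupport k).2 (Or.inl b.2)
  · rw [← congrFun hc ⟨β, hβ⟩, spectralMatrix_mulVec]

theorem Generic.eq_zero_of_eval_node_eq_zero (h : Generic q t) {S : Finset (Fin n →₀ ℕ)}
    {p : MvPolynomial (Fin n) k} (hp : p ∈ restrictSupport k (S : Set (Fin n →₀ ℕ)))
    (hzero : ∀ β ∈ S, eval (node q t β) p = 0) : p = 0 := by
  classical
  have hsum : p = ∑ c : S, monomial (c : Fin n →₀ ℕ) (p.coeff c) := by
    rw [Finset.sum_coe_sort S fun c => monomial c (p.coeff c)]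
    conv_lhs => rw [p.as_sum]
    exact Finset.sum_subset hp fun c _ hc => by rw [notMem_support_iff.1 hc, monomial_zero]
  have hcoeff : (fun c : S => p.coeff c) = 0 := by
    refine Matrix.eq_zero_of_mulVec_eq_zero
      (h.det_spectralMatrix_ne_zero (Subtype.val_injective (p := (· ∈ S)))) (funext fun b => ?_)
    rw [spectralMatrix_mulVec, ← hsum, hzero b b.2, Pi.zero_apply]
  rw [hsum]
  exact Finset.sum_eq_zero fun c _ => by rw [congrFun hcoeff c, Pi.zero_apply, monomial_zero]

/-- The exponents of degree at most `d`. -/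
def exponents (n d : ℕ) : Finset (Fin n →₀ ℕ) :=
  (Finsupp.finite_of_degree_le (σ := Fin n) d).toFinset

theorem mem_exponents {d : ℕ} {β : Fin n →₀ ℕ} : β ∈ exponents n d ↔ ∑ i, β i ≤ d := by
  simp [exponents, Finsupp.degree_eq_sum]

theorem mem_restrictSupport_exponents {d : ℕ} {p : MvPolynomial (Fin n) k} :
    p ∈ restrictSupport k (exponents n d : Set (Fin n →₀ ℕ)) ↔ p.totalDegree ≤ d := by
  rw [← mem_restrictTotalDegree, restrictTotalDegree]
  congr! 3
  ext β
  simp [mem_exponents, Finsupp.sum_fintype]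

theorem Generic.eq_of_eval_node_eq (h : Generic q t) {d : ℕ} {p p' : MvPolynomial (Fin n) k}
    (hp : p.totalDegree ≤ d) (hp' : p'.totalDegree ≤ d)
    (heq : ∀ β : Fin n → ℕ, ∑ i, β i ≤ d → eval (node q t β) p = eval (node q t β) p') :
    p = p' := by
  refine sub_eq_zero.1 (h.eq_zero_of_eval_node_eq_zero (mem_restrictSupport_exponents.2
    ((totalDegree_sub p p').trans (max_le hp hp'))) fun β hβ => ?_)
  rw [map_sub, heq β (mem_exponents.1 hβ), sub_self]

theorem Generic.exists_isInterpolation (h : Generic q t) (α : Fin n → ℕ) :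
    ∃ p, IsInterpolation q t α p := by
  classical
  set m : Fin n →₀ ℕ := Finsupp.equivFunOnFinite.symm α
  set d := ∑ i, α i
  obtain ⟨r, hr, hval⟩ := h.exists_eval_node_eq ((exponents n d).erase m) fun β =>
    eval (node q t β) (monomial m (1 : k))
  refine ⟨monomial m 1 - r, ?_, fun β hβ hne => ?_, ?_⟩
  · refine mem_restrictSupport_exponents.1 (Submodule.sub_mem _ ?_ ?_)
    · exact (monomial_mem_restrictSupport k).2 (Or.inl (mem_exponents.2 le_rfl))
    · exact restrictSupport_mono k (by exact_mod_cast Finset.erase_subset _ _) hr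
  · have hmem : Finsupp.equivFunOnFinite.symm β ∈ (exponents n d).erase m :=
      Finset.mem_erase.2 ⟨fun e => hne (Finsupp.equivFunOnFinite.symm.injective e),
        mem_exponents.2 hβ⟩
    rw [map_sub]
    exact sub_eq_zero.2 (hval _ hmem).symm
  · have hnot : r.coeff m = 0 :=
      notMem_support_iff.1 fun hmem => (Finset.mem_erase.1 (hr hmem)).1 rfl
    rw [coeff_sub, coeff_monomial, if_pos rfl, hnot, sub_zero]

theorem IsInterpolation.eval_node_ne_zero (h : Generic q t) {α : Fin n → ℕ}
    {p : MvPolynomial (Fin n) k} (hp : IsInterpolation q t α p) : eval (node q t α) p ≠ 0 := by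
  intro hzero
  have hp0 : p = 0 := by
    refine h.eq_of_eval_node_eq hp.totalDegree_le (by simp) fun β hβ => ?_
    by_cases hne : β = α
    · rw [hne, hzero, map_zero]
    · rw [hp.vanishing β hβ hne, map_zero]
  simpa [hp0] using hp.coeff_eq_one

theorem IsInterpolation.eq_smul (h : Generic q t) {α : Fin n → ℕ}
    {g p : MvPolynomial (Fin n) k} (hg : IsInterpolation q t α g)
    (hd : p.totalDegree ≤ ∑ i, α i)
    (hp : ∀ β : Fin n → ℕ, ∑ i, β i ≤ ∑ i, α i → β ≠ α → eval (node q t β) p = 0) :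
    p = (eval (node q t α) p / eval (node q t α) g) • g := by
  refine h.eq_of_eval_node_eq hd
    ((totalDegree_smul_le _ _).trans hg.totalDegree_le) fun β hβ => ?_
  rw [smul_eval]
  by_cases hne : β = α
  · rw [hne, div_mul_cancel₀ _ (hg.eval_node_ne_zero h)]
  · rw [hp β hβ hne, hg.vanishing β hβ hne, mul_zero]

theorem IsInterpolation.unique (h : Generic q t) {α : Fin n → ℕ} {g g' : MvPolynomial (Fin n) k}
    (hg : IsInterpolation q t α g) (hg' : IsInterpolation q t α g') : g' = g := by
  have hsmul := hg.eq_smul h hg'.totalDegree_le hg'.vanishing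
  have hcoeff := congrArg (coeff (Finsupp.equivFunOnFinite.symm α)) hsmul
  rw [coeff_smul, hg.coeff_eq_one, hg'.coeff_eq_one, smul_eq_mul, mul_one] at hcoeff
  rw [hsmul, ← hcoeff, one_smul]

theorem IsInterpolation.map {K : Type*} [Field K] {α : Fin n → ℕ} {p : MvPolynomial (Fin n) k}
    (hp : IsInterpolation q t α p) (f : k →+* K) :
    IsInterpolation (f q) (f t) α (MvPolynomial.map f p) := by
  refine ⟨(Finset.sup_mono (support_map_subset f p)).trans hp.totalDegree_le,
    fun β hβ hne => ?_, ?_⟩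
  · have hnode : node (f q) (f t) β = f ∘ node q t β := funext fun i => (map_node f β i).symm
    change eval (node (f q) (f t) β) _ = 0
    rw [hnode, eval_map, ← eval₂_comp, hp.vanishing β hβ hne, map_zero]
  · rw [coeff_map, hp.coeff_eq_one, map_one]

/-- The interpolation polynomial of `α` over an arbitrary field; it is `G` over `ℚ(q,t)`. -/
def interp (q t : k) (α : Fin n → ℕ) : MvPolynomial (Fin n) k :=
  Classical.epsilon (IsInterpolation q t α)

theorem Generic.isInterpolation_interp (h : Generic q t) (α : Fin n → ℕ) :
    IsInterpolation q t α (interp q t α) :=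
  Classical.epsilon_spec (h.exists_isInterpolation α)

end Interpolation

theorem generic_FF : Generic qF tF := by
  -- the instance behind `transcendental_X`, not defeq to the `ℚ`-algebra of a division ring
  let _ : Algebra ℚ (RatFunc ℚ) := RatFunc.instAlgebraOfPolynomial ℚ ℚ
  exact generic_of_transcendental (k := ℚ) RatFunc.transcendental_X RatFunc.transcendental_X

theorem generic_KK : Generic (q : KK) (t : KK) :=
  generic_FF.map (algebraMap FF KK)

theorem GK_eq_interp {n : ℕ} (α : Fin n → ℕ) : GK α = interp (q : KK) (t : KK) α :=
  (generic_KK.isInterpolation_interp α).unique generic_KK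
    ((generic_FF.isInterpolation_interp α).map (algebraMap FF KK))

/-! ### Operators on polynomials -/

section DividedDifference

variable {σ R : Type*} [DecidableEq σ] [CommRing R]

theorem X_sub_X_dvd_rename_swap_sub (i j : σ) (p : MvPolynomial σ R) :
    (X i - X j : MvPolynomial σ R) ∣ rename (Equiv.swap i j) p - p := by
  rw [← Ideal.mem_span_singleton, ← Ideal.Quotient.mk_eq_mk_iff_sub_mem]
  set I : Ideal (MvPolynomial σ R) := Ideal.span {X i - X j}
  have hX : Ideal.Quotient.mk I (X i) = Ideal.Quotient.mk I (X j) :=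
    Ideal.Quotient.mk_eq_mk_iff_sub_mem _ _ |>.2 (Ideal.mem_span_singleton_self _)
  have hcomp : (Ideal.Quotient.mkₐ R I).comp (rename (Equiv.swap i j)) =
      Ideal.Quotient.mkₐ R I := by
    ext l
    simp only [AlgHom.comp_apply, rename_X, Ideal.Quotient.mkₐ_eq_mk, Equiv.swap_apply_def]
    split_ifs with hi hj
    · rw [hi, hX]
    · rw [hj, hX]
    · rfl
  exact AlgHom.congr_fun hcomp p

/-- The divided difference `(s p - p) / (xᵢ - xⱼ)`, where `s` exchanges `xᵢ` and `xⱼ`. -/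
def divDiff (i j : σ) (p : MvPolynomial σ R) : MvPolynomial σ R :=
  Classical.choose (X_sub_X_dvd_rename_swap_sub i j p)

theorem rename_swap_sub (i j : σ) (p : MvPolynomial σ R) :
    rename (Equiv.swap i j) p - p = (X i - X j) * divDiff i j p :=
  Classical.choose_spec (X_sub_X_dvd_rename_swap_sub i j p)

theorem eval_comp_swap_sub (i j : σ) (p : MvPolynomial σ R) (y : σ → R) :
    eval (y ∘ Equiv.swap i j) p - eval y p = (y i - y j) * eval y (divDiff i j p) := by
  simpa [eval_rename] using congrArg (eval y) (rename_swap_sub i j p)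

theorem totalDegree_divDiff_lt [IsDomain R] {i j : σ} (hij : i ≠ j) {p : MvPolynomial σ R}
    (hp : divDiff i j p ≠ 0) : (divDiff i j p).totalDegree < p.totalDegree := by
  have hX : (X i - X j : MvPolynomial σ R) ≠ 0 := sub_ne_zero.2 (X_injective.ne hij)
  have hdegX : (X i - X j : MvPolynomial σ R).totalDegree = 1 :=
    ((isHomogeneous_X R i).sub (isHomogeneous_X R j)).totalDegree hX
  have hdeg : (X i - X j : MvPolynomial σ R).totalDegree + (divDiff i j p).totalDegree ≤
      p.totalDegree := by
    rw [← totalDegree_mul_of_isDomain hX hp, ← rename_swap_sub]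
    exact (totalDegree_sub _ _).trans (max_le (totalDegree_rename_le _ _) le_rfl)
  omega

/-- The Demazure–Lusztig operator `t + (xᵢ - t xⱼ) / (xᵢ - xⱼ) (s - 1)` on polynomials. -/
def heckePoly (t : R) (i j : σ) (p : MvPolynomial σ R) : MvPolynomial σ R :=
  t • p + (X i - t • X j) * divDiff i j p

theorem eval_heckePoly_of_eq_zero (t : R) {i j : σ} {y : σ → R} (hy : y i = 0)
    (p : MvPolynomial σ R) :
    eval y (heckePoly t i j p) = t * eval (y ∘ Equiv.swap i j) p := by
  have hswap := eval_comp_swap_sub i j p y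
  simp only [heckePoly, map_add, map_mul, map_sub, smul_eval, eval_X, hy, zero_sub] at hswap ⊢
  linear_combination (-t) * hswap

theorem totalDegree_heckePoly_le [IsDomain R] (t : R) {i j : σ} (hij : i ≠ j)
    (p : MvPolynomial σ R) : (heckePoly t i j p).totalDegree ≤ p.totalDegree := by
  refine (totalDegree_add _ _).trans (max_le (totalDegree_smul_le _ _) ?_)
  by_cases hp : divDiff i j p = 0
  · simp [hp]
  have hX : (X i - t • X j : MvPolynomial σ R).totalDegree ≤ 1 :=
    (totalDegree_sub _ _).trans (max_le (totalDegree_X i).le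
      ((totalDegree_smul_le _ _).trans (totalDegree_X j).le))
  have hlt := totalDegree_divDiff_lt hij hp
  exact (totalDegree_mul _ _).trans (by omega)

end DividedDifference

section HeckeCoeff

variable {k σ : Type*} [Field k] [DecidableEq σ]

/-- The coefficient `(yᵢ - t yⱼ) / (yᵢ - yⱼ)` of the Demazure–Lusztig operators. -/
def heckeCoeff (t : k) (i j : σ) (y : σ → k) : k := (y i - t * y j) / (y i - y j)

theorem eval_heckePoly (t : k) {i j : σ} {y : σ → k} (hy : y i ≠ y j) (p : MvPolynomial σ k) :
    eval y (heckePoly t i j p) =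
      t * eval y p + heckeCoeff t i j y * (eval (y ∘ Equiv.swap i j) p - eval y p) := by
  have hsub := sub_ne_zero.2 hy
  rw [eval_comp_swap_sub]
  simp only [heckePoly, heckeCoeff, map_add, map_mul, map_sub, smul_eval, eval_X]
  field_simp

end HeckeCoeff

section Raise

theorem totalDegree_bind₁_le {σ τ R : Type*} [CommSemiring R] {f : σ → MvPolynomial τ R}
    (hf : ∀ i, (f i).totalDegree ≤ 1) (p : MvPolynomial σ R) :
    (bind₁ f p).totalDegree ≤ p.totalDegree := by
  rw [← aeval_eq_bind₁, aeval_def, eval₂_eq]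
  refine totalDegree_finsetSum_le fun d hd => ?_
  rw [algebraMap_eq, ← smul_eq_C_mul]
  refine (totalDegree_smul_le _ _).trans ((totalDegree_finsetProd _ _).trans ?_)
  refine (Finset.sum_le_sum fun i _ => (totalDegree_pow _ _).trans ?_).trans (le_totalDegree hd)
  exact (Nat.mul_le_mul_left _ (hf i)).trans_eq (mul_one _)

variable {k : Type*} [Field k] {N : ℕ}

/-- The affine rotation `(y₁, …, yₙ) ↦ (q⁻¹ yₙ, y₁, …, yₙ₋₁)`. -/
def rot (q : k) (y : Fin (N + 1) → k) : Fin (N + 1) → k :=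
  Fin.cons (q⁻¹ * y (Fin.last N)) fun i => y i.castSucc

/-- The raising operator `f(x) ↦ (xₙ - t^{1-n}) f(q⁻¹ xₙ, x₁, …, xₙ₋₁)`. -/
def raise (q t : k) (p : MvPolynomial (Fin (N + 1)) k) : MvPolynomial (Fin (N + 1)) k :=
  (X (Fin.last N) - C (t ^ (-(N : ℤ)))) *
    bind₁ (Fin.cons (q⁻¹ • X (Fin.last N)) fun i => X i.castSucc) p

theorem eval_raise (q t : k) (y : Fin (N + 1) → k) (p : MvPolynomial (Fin (N + 1)) k) :
    eval y (raise q t p) = (y (Fin.last N) - t ^ (-(N : ℤ))) * eval (rot q y) p := by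
  have hrot : rot q y = fun i => eval y
      ((Fin.cons (q⁻¹ • X (Fin.last N)) fun i => X i.castSucc :
        Fin (N + 1) → MvPolynomial (Fin (N + 1)) k) i) := by
    ext i
    cases i using Fin.cases <;> simp [rot, smul_eval]
  rw [raise, map_mul, map_sub, eval_X, eval_C, hrot]
  exact congrArg _ (eval₂Hom_bind₁ _ _ _ _)

theorem totalDegree_raise_le (q t : k) (p : MvPolynomial (Fin (N + 1)) k) :
    (raise q t p).totalDegree ≤ p.totalDegree + 1 := by
  have hlin : (X (Fin.last N) - C (t ^ (-(N : ℤ))) :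
      MvPolynomial (Fin (N + 1)) k).totalDegree ≤ 1 :=
    (totalDegree_sub _ _).trans (max_le (totalDegree_X _).le (by simp))
  refine (totalDegree_mul _ _).trans ((add_comm _ _).trans_le (add_le_add ?_ hlin))
  refine totalDegree_bind₁_le (fun i => ?_) p
  cases i using Fin.cases with
  | zero => exact (totalDegree_smul_le _ _).trans (totalDegree_X _).le
  | succ i => exact (totalDegree_X _).le

theorem X_zero_dvd [Infinite k] {p : MvPolynomial (Fin (N + 1)) k}
    (hp : ∀ z : Fin N → k, eval (Fin.cons 0 z) p = 0) : X 0 ∣ p := by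
  rw [← map_dvd_iff (finSuccEquiv k N), finSuccEquiv_X_zero, Polynomial.X_dvd_iff]
  refine MvPolynomial.funext fun z => ?_
  rw [map_zero, ← hp z, eval_eq_eval_mv_eval', ← Polynomial.coeff_zero_eq_eval_zero,
    Polynomial.coeff_map]

end Raise

/-! ### Recursions for interpolation polynomials -/

section HeckeRecursion

variable {k : Type*} [Field k] {q t : k} {n : ℕ}

theorem comp_swap_eq_self {ι A : Type*} [DecidableEq ι] {v : ι → A} {i j : ι} (hv : v i = v j) :
    v ∘ Equiv.swap i j = v := by
  rw [Equiv.comp_swap_eq_update, hv, Function.update_eq_self, ← hv, Function.update_eq_self]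

theorem comp_swap_comp_swap {ι A : Type*} [DecidableEq ι] (v : ι → A) (i j : ι) :
    (v ∘ Equiv.swap i j) ∘ Equiv.swap i j = v := by
  ext l
  simp

theorem sum_comp_swap {ι : Type*} [Fintype ι] [DecidableEq ι] (β : ι → ℕ) (i j : ι) :
    ∑ l, (β ∘ Equiv.swap i j) l = ∑ l, β l :=
  Equiv.sum_comp (Equiv.swap i j) β

theorem ne_of_val_eq_succ {i j : Fin n} (hij : (j : ℕ) = i + 1) : i ≠ j := by
  rintro rfl
  omega

theorem heckeCoeff_eq_zero {i j : Fin n} {y : Fin n → k} (hy : y i = t * y j) :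
    heckeCoeff t i j y = 0 := by
  rw [heckeCoeff, hy, sub_self, zero_div]

theorem heckeCoeff_bar_of_eq (ht : t ≠ 0) {v : Fin n → ℤ} {i j : Fin n}
    (hij : (j : ℕ) = i + 1) (hv : v i = v j) : heckeCoeff t i j (bar q t v) = 0 :=
  heckeCoeff_eq_zero (bar_of_eq ht v hij hv)

theorem Generic.heckeCoeff_bar_ne_zero (h : Generic q t) {v : Fin n → ℤ} {i j : Fin n}
    (hij : (j : ℕ) = i + 1) (hv : v i ≠ v j) : heckeCoeff t i j (bar q t v) ≠ 0 :=
  div_ne_zero (fun e => hv (h.eq_of_bar_eq_mul (sub_eq_zero.1 e)))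
    (sub_ne_zero.2 ((h.bar_injective v).ne (ne_of_val_eq_succ hij)))

/-- When `vᵢ = vⱼ` the points `s v̄` and the spectral point of `s v` differ, but the coefficient
vanishes. -/
theorem heckeCoeff_bar_mul_comp_swap (ht : t ≠ 0) (f : (Fin n → k) → k) (v : Fin n → ℤ)
    {i j : Fin n} (hij : (j : ℕ) = i + 1) :
    heckeCoeff t i j (bar q t v) * f (bar q t v ∘ Equiv.swap i j) =
      heckeCoeff t i j (bar q t v) * f (bar q t (v ∘ Equiv.swap i j)) := by
  by_cases hv : v i = v j
  · rw [heckeCoeff_bar_of_eq ht hij hv, zero_mul, zero_mul]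
  · rw [bar_comp_swap v hij hv]

theorem Generic.eval_node_heckePoly (h : Generic q t) (β : Fin n → ℕ) {i j : Fin n}
    (hij : (j : ℕ) = i + 1) (p : MvPolynomial (Fin n) k) :
    eval (node q t β) (heckePoly t i j p) = t * eval (node q t β) p +
      heckeCoeff t i j (node q t β) *
        (eval (node q t (β ∘ Equiv.swap i j)) p - eval (node q t β) p) := by
  have hne : node q t β i ≠ node q t β j := (h.bar_injective _).ne (ne_of_val_eq_succ hij)
  rw [eval_heckePoly t hne, mul_sub, mul_sub]
  congr 2
  exact heckeCoeff_bar_mul_comp_swap h.t_ne_zero (eval · p) _ hij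

theorem IsInterpolation.eval_node_heckePoly_eq_zero (h : Generic q t) {α β : Fin n → ℕ}
    {i j : Fin n} (hij : (j : ℕ) = i + 1) {g : MvPolynomial (Fin n) k}
    (hg : IsInterpolation q t α g) (hβ : ∑ l, β l ≤ ∑ l, α l) (hne : β ≠ α)
    (hne' : β ∘ Equiv.swap i j ≠ α) : eval (node q t β) (heckePoly t i j g) = 0 := by
  rw [h.eval_node_heckePoly β hij, hg.vanishing β hβ hne,
    hg.vanishing _ ((sum_comp_swap β i j).trans_le hβ) hne']
  ring

theorem IsInterpolation.heckePoly_of_eq (h : Generic q t) {α : Fin n → ℕ} {i j : Fin n}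
    (hij : (j : ℕ) = i + 1) (hα : α i = α j) {g : MvPolynomial (Fin n) k}
    (hg : IsInterpolation q t α g) : heckePoly t i j g = t • g := by
  refine h.eq_of_eval_node_eq
    ((totalDegree_heckePoly_le t (ne_of_val_eq_succ hij) g).trans hg.totalDegree_le)
    ((totalDegree_smul_le _ _).trans hg.totalDegree_le) fun β hβ => ?_
  rw [smul_eval]
  by_cases hβα : β = α
  · rw [h.eval_node_heckePoly β hij, hβα,
      heckeCoeff_bar_of_eq h.t_ne_zero hij (by exact_mod_cast hα), zero_mul, add_zero]
  · rw [hg.vanishing β hβ hβα, mul_zero]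
    refine hg.eval_node_heckePoly_eq_zero h hij hβ hβα fun e => hβα ?_
    rw [← comp_swap_comp_swap β i j, e, comp_swap_eq_self hα]

theorem IsInterpolation.heckePoly_of_ne (h : Generic q t) {α : Fin n → ℕ} {i j : Fin n}
    (hij : (j : ℕ) = i + 1) (hα : α i ≠ α j) {g g' : MvPolynomial (Fin n) k}
    (hg : IsInterpolation q t α g) (hg' : IsInterpolation q t (α ∘ Equiv.swap i j) g') :
    ∃ e : k, heckePoly t i j g = (t - heckeCoeff t i j (node q t α)) • g + e • g' := by
  set s := t - heckeCoeff t i j (node q t α) with hs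
  have hαs : α ∘ Equiv.swap i j ≠ α := fun e => hα <| by
    simpa using (congrFun e j)
  have hdeg : (heckePoly t i j g - s • g).totalDegree ≤ ∑ l, (α ∘ Equiv.swap i j) l := by
    rw [sum_comp_swap]
    exact (totalDegree_sub _ _).trans (max_le
      ((totalDegree_heckePoly_le t (ne_of_val_eq_succ hij) g).trans hg.totalDegree_le)
      ((totalDegree_smul_le _ _).trans hg.totalDegree_le))
  refine ⟨_, sub_eq_iff_eq_add'.1 (hg'.eq_smul h hdeg fun β hβ hβne => ?_)⟩
  rw [sum_comp_swap] at hβ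
  rw [map_sub, smul_eval]
  by_cases hβα : β = α
  · subst hβα
    rw [h.eval_node_heckePoly β hij, hs, hg.vanishing _ (sum_comp_swap β i j).le hαs]
    ring
  · rw [hg.vanishing β hβ hβα, mul_zero, sub_zero]
    refine hg.eval_node_heckePoly_eq_zero h hij hβ hβα fun e => hβne ?_
    rw [← e, comp_swap_comp_swap]

end HeckeRecursion

section RaisingRecursion

variable {k : Type*} [Field k] {q t : k} {N : ℕ}

theorem sum_cyc (α : Fin (N + 1) → ℕ) : ∑ i, cyc α i = ∑ i, α i + 1 := by
  rw [Fin.sum_univ_castSucc, Fin.sum_univ_succ α, cyc_last]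
  simp only [cyc_castSucc]
  ring

theorem natCast_cyc (α : Fin (N + 1) → ℕ) :
    (fun i => ((cyc α i : ℕ) : ℤ)) = cyc fun i => (α i : ℤ) := by
  ext i
  cases i using Fin.lastCases <;> simp [cyc]

theorem exists_cyc_eq {β : Fin (N + 1) → ℕ} (h : β (Fin.last N) ≠ 0) : ∃ γ, cyc γ = β := by
  refine ⟨Fin.cons (β (Fin.last N) - 1) fun i => β i.castSucc, ?_⟩
  ext i
  cases i using Fin.lastCases with
  | last =>
    rw [cyc_last, Fin.cons_zero]
    omega
  | cast i => rw [cyc_castSucc, Fin.cons_succ]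

theorem rot_bar_cyc (hq : q ≠ 0) (v : Fin (N + 1) → ℤ) : rot q (bar q t (cyc v)) = bar q t v := by
  ext i
  cases i using Fin.cases with
  | zero => rw [rot, Fin.cons_zero, bar_cyc_last hq, inv_mul_cancel_left₀ hq]
  | succ i => rw [rot, Fin.cons_succ, bar_cyc_castSucc]

theorem rot_node_cyc (hq : q ≠ 0) (α : Fin (N + 1) → ℕ) :
    rot q (node q t (cyc α)) = node q t α := by
  rw [node, natCast_cyc, rot_bar_cyc hq]

theorem IsInterpolation.eval_node_raise_eq_zero (hq : q ≠ 0) {α β : Fin (N + 1) → ℕ}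
    {g : MvPolynomial (Fin (N + 1)) k} (hg : IsInterpolation q t α g)
    (hβ : ∑ i, β i ≤ ∑ i, cyc α i) (hne : β ≠ cyc α) : eval (node q t β) (raise q t g) = 0 := by
  rw [eval_raise]
  by_cases hlast : β (Fin.last N) = 0
  · have hnode : node q t β (Fin.last N) = t ^ (-(N : ℤ)) :=
      bar_last_of_nonneg _ (fun i => by positivity) (by exact_mod_cast hlast)
    rw [hnode, sub_self, zero_mul]
  · obtain ⟨γ, rfl⟩ := exists_cyc_eq hlast
    rw [sum_cyc, sum_cyc] at hβ
    rw [rot_node_cyc hq, hg.vanishing γ (by omega) fun e => hne (congrArg cyc e), mul_zero]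

theorem IsInterpolation.exists_raise_eq_smul (h : Generic q t) {α : Fin (N + 1) → ℕ}
    {g g' : MvPolynomial (Fin (N + 1)) k} (hg : IsInterpolation q t α g)
    (hg' : IsInterpolation q t (cyc α) g') : ∃ c : k, raise q t g = c • g' :=
  ⟨_, hg'.eq_smul h ((totalDegree_raise_le q t g).trans
    ((Nat.add_le_add_right hg.totalDegree_le 1).trans_eq (sum_cyc α).symm))
    fun _ => hg.eval_node_raise_eq_zero h.q_ne_zero⟩

end RaisingRecursion

section CherednikOperator

variable {k : Type*} [Field k] {q t : k} {N : ℕ}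

/-- The geometric point `b (1, t⁻¹, …, t^{1-n})`. -/
def geom {n : ℕ} (t b : k) : Fin n → k := fun i => b * t ^ (-((i : ℕ) : ℤ))

theorem geom_zero (b : k) : (geom t b : Fin (N + 1) → k) 0 = b := by simp [geom]

theorem geom_eq_mul {n : ℕ} (ht : t ≠ 0) (b : k) {i j : Fin n} (hij : (j : ℕ) = i + 1) :
    geom t b i = t * geom t b j := by
  rw [geom, geom, hij, mul_left_comm, ← zpow_one_add₀ ht]
  congr 2
  push_cast
  ring

theorem Generic.geom_ne {n : ℕ} (h : Generic q t) {b : k} (hb : b ≠ 0) {i j : Fin n}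
    (hij : (j : ℕ) = i + 1) : geom t b i ≠ geom t b j := by
  have hj : geom t b j ≠ 0 := mul_ne_zero hb (zpow_ne_zero _ h.t_ne_zero)
  rw [geom_eq_mul h.t_ne_zero b hij]
  exact fun e => h.t_ne_one (mul_eq_right₀ hj |>.1 e)

theorem Generic.eval_geom_heckePoly {n : ℕ} (h : Generic q t) {b : k} (hb : b ≠ 0) {i j : Fin n}
    (hij : (j : ℕ) = i + 1) (p : MvPolynomial (Fin n) k) :
    eval (geom t b) (heckePoly t i j p) = t * eval (geom t b) p := by
  rw [eval_heckePoly t (h.geom_ne hb hij), heckeCoeff_eq_zero (geom_eq_mul h.t_ne_zero b hij),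
    zero_mul, add_zero]

/-- The polynomial `Hᵢ Hᵢ₊₁ ⋯ H_{n-1} p`; applied to `raise q t p` and at `i = 0` it is the
nontrivial term of the first inhomogeneous Cherednik operator. -/
def heckeChain (t : k) (p : MvPolynomial (Fin (N + 1)) k) (i : Fin (N + 1)) :
    MvPolynomial (Fin (N + 1)) k :=
  Fin.reverseInduction (motive := fun _ => MvPolynomial (Fin (N + 1)) k) p
    (fun i r => heckePoly t i.castSucc i.succ r) i

theorem heckeChain_last (p : MvPolynomial (Fin (N + 1)) k) :
    heckeChain t p (Fin.last N) = p :=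
  Fin.reverseInduction_last

theorem heckeChain_castSucc (p : MvPolynomial (Fin (N + 1)) k) (i : Fin N) :
    heckeChain t p i.castSucc = heckePoly t i.castSucc i.succ (heckeChain t p i.succ) :=
  Fin.reverseInduction_castSucc _

theorem totalDegree_heckeChain_le (p : MvPolynomial (Fin (N + 1)) k) (i : Fin (N + 1)) :
    (heckeChain t p i).totalDegree ≤ p.totalDegree := by
  induction i using Fin.reverseInduction with
  | last => rw [heckeChain_last]
  | cast i ih =>
    rw [heckeChain_castSucc]
    exact (totalDegree_heckePoly_le t (ne_of_val_eq_succ rfl) _).trans ih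

theorem Generic.eval_node_heckeChain (h : Generic q t) {d : ℕ} {p : MvPolynomial (Fin (N + 1)) k}
    (hp : ∀ β : Fin (N + 1) → ℕ, ∑ l, β l ≤ d → eval (node q t β) p = 0) (i : Fin (N + 1))
    {β : Fin (N + 1) → ℕ} (hβ : ∑ l, β l ≤ d) : eval (node q t β) (heckeChain t p i) = 0 := by
  induction i using Fin.reverseInduction generalizing β with
  | last => rw [heckeChain_last, hp β hβ]
  | cast i ih =>
    rw [heckeChain_castSucc, h.eval_node_heckePoly β rfl, ih hβ,
      ih ((sum_comp_swap β _ _).trans_le hβ)]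
    ring

theorem Generic.eval_geom_heckeChain (h : Generic q t) {b : k} (hb : b ≠ 0)
    (p : MvPolynomial (Fin (N + 1)) k) (i : Fin (N + 1)) :
    eval (geom t b) (heckeChain t p i) = t ^ (N - i) * eval (geom t b) p := by
  induction i using Fin.reverseInduction with
  | last => simp [heckeChain_last]
  | cast i ih =>
    have hexp : N - (i.castSucc : ℕ) = N - i.succ + 1 := by simp; omega
    rw [heckeChain_castSucc, h.eval_geom_heckePoly hb rfl, ih, hexp, pow_succ']
    ring

theorem insertNth_castSucc_comp_swap {A : Type*} (i : Fin N) (a : A) (z : Fin N → A) :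
    (i.castSucc.insertNth a z : Fin (N + 1) → A) ∘ Equiv.swap i.castSucc i.succ =
      i.succ.insertNth a z := by
  have hswap : ∀ l, Equiv.swap i.castSucc i.succ (i.succ.succAbove l) = i.castSucc.succAbove l := by
    intro l
    simp only [Equiv.swap_apply_def, Fin.succAbove, Fin.lt_def, Fin.ext_iff]
    split_ifs <;> simp_all <;> omega
  rw [Fin.eq_insertNth_iff]
  refine ⟨by simp, funext fun l => ?_⟩
  rw [Fin.removeNth_apply, Function.comp_apply, hswap, Fin.insertNth_apply_succAbove]

theorem eval_heckeChain_insertNth_zero (p : MvPolynomial (Fin (N + 1)) k) (i : Fin (N + 1))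
    (z : Fin N → k) :
    eval (i.insertNth 0 z) (heckeChain t p i) = t ^ (N - i) * eval (Fin.snoc z 0) p := by
  induction i using Fin.reverseInduction with
  | last => simp [heckeChain_last]
  | cast i ih =>
    have hexp : N - (i.castSucc : ℕ) = N - i.succ + 1 := by simp; omega
    rw [heckeChain_castSucc, eval_heckePoly_of_eq_zero t (by simp), insertNth_castSucc_comp_swap,
      ih, hexp, pow_succ']
    ring

theorem X_zero_dvd_add_heckeChain_raise [Infinite k] (ht : t ≠ 0)
    (p : MvPolynomial (Fin (N + 1)) k) : X 0 ∣ p + heckeChain t (raise q t p) 0 := by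
  refine X_zero_dvd fun z => ?_
  have hrot : rot q (Fin.snoc z 0) = Fin.cons 0 z := by
    ext i
    cases i using Fin.cases <;> simp [rot]
  have hchain := eval_heckeChain_insertNth_zero (t := t) (raise q t p) 0 z
  rw [eval_raise, hrot, Fin.snoc_last, zero_sub, zpow_neg, zpow_natCast, Fin.insertNth_zero',
    Fin.val_zero, Nat.sub_zero, neg_mul, mul_neg, mul_inv_cancel_left₀ (pow_ne_zero N ht)]
    at hchain
  rw [map_add, hchain, add_neg_cancel]

theorem IsInterpolation.add_heckeChain_raise (h : Generic q t) {α : Fin (N + 1) → ℕ}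
    {g : MvPolynomial (Fin (N + 1)) k} (hg : IsInterpolation q t α g) :
    g + heckeChain t (raise q t g) 0 = X 0 * ((node q t α 0)⁻¹ • g) := by
  have := h.infinite
  have hlt := sum_cyc α
  have hraise : ∀ β : Fin (N + 1) → ℕ, ∑ i, β i ≤ ∑ i, α i →
      eval (node q t β) (raise q t g) = 0 := fun β hβ =>
    hg.eval_node_raise_eq_zero h.q_ne_zero (by omega) (by rintro rfl; omega)
  obtain ⟨r, hr⟩ := X_zero_dvd_add_heckeChain_raise (q := q) h.t_ne_zero g
  have hdeg : r.totalDegree ≤ ∑ i, α i := by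
    by_cases hr0 : r = 0
    · simp [hr0]
    have hXr := totalDegree_mul_of_isDomain (X_ne_zero (R := k) (0 : Fin (N + 1))) hr0
    rw [← hr, totalDegree_X] at hXr
    have hle := totalDegree_add g (heckeChain t (raise q t g) 0)
    have hmax : max g.totalDegree (heckeChain t (raise q t g) 0).totalDegree ≤ ∑ i, α i + 1 :=
      max_le (hg.totalDegree_le.trans (Nat.le_succ _)) ((totalDegree_heckeChain_le _ _).trans
        ((totalDegree_raise_le q t g).trans (Nat.add_le_add_right hg.totalDegree_le 1)))
    omega
  rw [hr]
  congr 1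
  refine h.eq_of_eval_node_eq hdeg ((totalDegree_smul_le _ _).trans hg.totalDegree_le) ?_
  intro β hβ
  have hval := congrArg (eval (node q t β)) hr
  have hne := bar_ne_zero h.q_ne_zero h.t_ne_zero (fun i => (β i : ℤ)) 0
  rw [map_add, map_mul, eval_X, h.eval_node_heckeChain hraise 0 hβ, add_zero] at hval
  rw [smul_eval]
  by_cases hβα : β = α
  · rw [← hβα, hval, inv_mul_cancel_left₀ hne]
  · rw [hg.vanishing β hβ hβα] at hval ⊢
    rw [mul_zero, (mul_eq_zero.1 hval.symm).resolve_left hne]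

theorem IsInterpolation.eval_geom_raise (h : Generic q t) {α : Fin (N + 1) → ℕ}
    {g : MvPolynomial (Fin (N + 1)) k} (hg : IsInterpolation q t α g) {b : k} (hb : b ≠ 0) :
    t ^ N * eval (geom t b) (raise q t g) =
      (b * (node q t α 0)⁻¹ - 1) * eval (geom t b) g := by
  have heigen := congrArg (eval (geom t b)) (hg.add_heckeChain_raise h)
  rw [map_add, h.eval_geom_heckeChain hb, map_mul, eval_X, geom_zero, smul_eval, Fin.val_zero,
    Nat.sub_zero] at heigen
  linear_combination heigen

end CherednikOperator

section CompositionInduction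

variable {N : ℕ}

theorem forall_of_last_ne_zero {P : (Fin (N + 1) → ℕ) → Prop} {d : ℕ}
    (hlast : ∀ α : Fin (N + 1) → ℕ, ∑ i, α i = d → α (Fin.last N) ≠ 0 → P α)
    (hswap : ∀ α (i j : Fin (N + 1)), (j : ℕ) = i + 1 → P (α ∘ Equiv.swap i j) → P α)
    (i : Fin (N + 1)) {α : Fin (N + 1) → ℕ} (hd : ∑ i, α i = d) (hi : α i ≠ 0) : P α := by
  induction i using Fin.reverseInduction generalizing α with
  | last => exact hlast α hd hi
  | cast i ih =>
    refine hswap α i.castSucc i.succ rfl (ih ((sum_comp_swap α _ _).trans hd) ?_)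
    simpa using hi

theorem composition_induction {P : (Fin (N + 1) → ℕ) → Prop} (zero : P 0)
    (cyc : ∀ α, P α → P (cyc α))
    (swap : ∀ α (i j : Fin (N + 1)), (j : ℕ) = i + 1 → P (α ∘ Equiv.swap i j) → P α)
    (α : Fin (N + 1) → ℕ) : P α := by
  induction hd : ∑ i, α i generalizing α with
  | zero =>
    have hα : α = 0 := funext fun i => (Finset.sum_eq_zero_iff.1 hd) i (Finset.mem_univ i)
    exact hα ▸ zero
  | succ d ih =>
    obtain ⟨i, -, hi⟩ := Finset.exists_ne_zero_of_sum_ne_zero (hd.trans_ne d.succ_ne_zero)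
    refine forall_of_last_ne_zero (fun β hβ hlast => ?_) swap i hd hi
    obtain ⟨γ, rfl⟩ := exists_cyc_eq hlast
    exact cyc γ (ih γ (by rw [sum_cyc] at hβ; omega))

end CompositionInduction

/-! ### Normalised interpolation polynomials -/

section Iterates

variable {N : ℕ}

theorem cyc_iterate {A : Type*} [Add A] [One A] (v : Fin (N + 1) → A) {m : ℕ} (hm : m ≤ N + 1)
    (l : Fin (N + 1)) :
    (cyc^[m] v) l = if h : l + m < N + 1 then v ⟨l + m, h⟩
      else v ⟨l + m - (N + 1), by omega⟩ + 1 := by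
  induction m generalizing l with
  | zero => rw [dif_pos (by omega)]; rfl
  | succ m ih =>
    rw [Function.iterate_succ_apply']
    cases l using Fin.lastCases with
    | last =>
      rw [cyc_last, ih (by omega), dif_pos (by simp; omega), dif_neg (by simp)]
      congr 2
      ext
      simp
      omega
    | cast l =>
      rw [cyc_castSucc, ih (by omega)]
      simp only [Fin.val_succ, Fin.val_castSucc, add_right_comm _ 1 m, add_assoc]

theorem cyc_iterate_full {A : Type*} [Add A] [One A] (v : Fin (N + 1) → A) :
    cyc^[N + 1] v = fun l => v l + 1 := by
  ext l
  rw [cyc_iterate v le_rfl, dif_neg (by omega)]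
  simp

variable {k : Type*} [Field k] {q t : k}

theorem bar_cyc_iterate (v : Fin (N + 1) → ℤ) {m : ℕ} (l : Fin (N + 1)) (h : l + m < N + 1) :
    bar q t (cyc^[m] v) l = bar q t v ⟨l + m, h⟩ := by
  induction m generalizing l with
  | zero => rfl
  | succ m ih =>
    rw [Function.iterate_succ_apply']
    obtain ⟨l, rfl⟩ : ∃ l' : Fin N, l = l'.castSucc := ⟨⟨l, by omega⟩, rfl⟩
    rw [Fin.val_castSucc] at h
    rw [bar_cyc_castSucc, ih _ (by rw [Fin.val_succ]; omega)]
    simp only [Fin.val_succ, Fin.val_castSucc, add_assoc, add_comm 1 m]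

theorem rot_iterate (y : Fin (N + 1) → k) {m : ℕ} (hm : m ≤ N + 1) (l : Fin (N + 1)) :
    ((rot q)^[m] y) l = if m ≤ (l : ℕ) then y ⟨l - m, by omega⟩
      else q⁻¹ * y (Fin.ofNat (N + 1) (N + 1 + l - m)) := by
  induction m generalizing l with
  | zero => simp
  | succ m ih =>
    rw [Function.iterate_succ_apply']
    cases l using Fin.cases with
    | zero =>
      have hmod : (N + 1 + 0 - (m + 1)) % (N + 1) = N - m := by
        rw [Nat.mod_eq_of_lt (by omega)]
        omega
      rw [rot, Fin.cons_zero, ih (by omega), if_pos (by simp; omega), if_neg (by simp)]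
      congr 2
      ext
      simp only [Fin.val_last, Fin.val_ofNat, Fin.val_zero, hmod]
    | succ l =>
      have hsub : N + 1 + (l + 1) - (m + 1) = N + 1 + l - m := by omega
      rw [rot, Fin.cons_succ, ih (by omega)]
      simp only [Fin.val_succ, Fin.val_castSucc, Nat.add_le_add_iff_right,
        Nat.add_sub_add_right, hsub]

theorem rot_iterate_full (y : Fin (N + 1) → k) : (rot q)^[N + 1] y = fun i => q⁻¹ * y i := by
  ext l
  have hmod : Fin.ofNat (N + 1) (N + 1 + l - (N + 1)) = l := by
    ext
    simp
  rw [rot_iterate y le_rfl, if_neg (by omega), hmod]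

theorem rot_mul_left (c : k) (y : Fin (N + 1) → k) :
    rot q (fun i => c * y i) = fun i => c * rot q y i := by
  ext i
  cases i using Fin.cases with
  | zero =>
    simp only [rot, Fin.cons_zero]
    ring
  | succ i => simp only [rot, Fin.cons_succ]

end Iterates

theorem heckeCoeff_mul_left {k : Type*} [Field k] {n : ℕ} (t : k) {c : k} (hc : c ≠ 0)
    (i j : Fin n) (y : Fin n → k) : heckeCoeff t i j (fun l => c * y l) = heckeCoeff t i j y := by
  rw [heckeCoeff, heckeCoeff, mul_left_comm t c, ← mul_sub, ← mul_sub,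
    mul_div_mul_left _ _ hc]

theorem heckeCoeff_inv {k : Type*} [Field k] {n : ℕ} (t : k) {i j : Fin n} {y : Fin n → k}
    (hi : y i ≠ 0) (hj : y j ≠ 0) :
    heckeCoeff t i j (fun l => (y l)⁻¹) = heckeCoeff t j i y := by
  rw [heckeCoeff, heckeCoeff, ← mul_div_mul_left _ _ (mul_ne_zero hi hj)]
  congr 1 <;> field_simp

section Composition

variable {k : Type*} [Field k] {q t a : k} {N : ℕ}

/-- The hypotheses on `q`, `t` and `a` under which `K_v` exists and can be evaluated at the
spectral points: `q` and `t` are generic and `a` is not a monomial in them. -/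
structure GenericParams (q t a : k) : Prop where
  generic : Generic q t
  a_ne_zero : a ≠ 0
  a_mul_ne_one : ∀ i j : ℤ, a * (q ^ i * t ^ j) ≠ 1

theorem GenericParams.one_sub_mul_bar_inv_ne_zero (h : GenericParams q t a) {n : ℕ}
    (v : Fin n → ℤ) (i : Fin n) : 1 - a * (bar q t v i)⁻¹ ≠ 0 := by
  rw [sub_ne_zero, bar, mul_inv, ← zpow_neg, ← zpow_neg]
  exact (h.a_mul_ne_one _ _).symm

theorem Generic.interp_zero (h : Generic q t) {n : ℕ} : interp q t (0 : Fin n → ℕ) = 1 := by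
  have hdeg := (h.isInterpolation_interp (0 : Fin n → ℕ)).totalDegree_le
  have hcoeff := (h.isInterpolation_interp (0 : Fin n → ℕ)).coeff_eq_one
  have hzero : Finsupp.equivFunOnFinite.symm (0 : Fin n → ℕ) = 0 := Finsupp.ext fun _ => rfl
  simp only [Pi.zero_apply, Finset.sum_const_zero, Nat.le_zero] at hdeg
  rw [totalDegree_eq_zero_iff_eq_C] at hdeg
  rw [hzero] at hcoeff
  rw [hdeg, hcoeff, C_1]

theorem Generic.eval_geom_interp_of_ne (h : Generic q t) {α : Fin (N + 1) → ℕ}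
    {i j : Fin (N + 1)} (hij : (j : ℕ) = i + 1) {b : k} (hb : b ≠ 0) {e : k}
    (he : heckePoly t i j (interp q t α) = (t - heckeCoeff t i j (node q t α)) • interp q t α +
      e • interp q t (α ∘ Equiv.swap i j)) :
    e * eval (geom t b) (interp q t (α ∘ Equiv.swap i j)) =
      heckeCoeff t i j (node q t α) * eval (geom t b) (interp q t α) := by
  have hgeom := congrArg (eval (geom t b)) he
  rw [h.eval_geom_heckePoly hb hij, map_add, smul_eval, smul_eval] at hgeom
  linear_combination -hgeom

theorem GenericParams.eval_geom_interp_ne_zero (h : GenericParams q t a)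
    (α : Fin (N + 1) → ℕ) : eval (geom t a) (interp q t α) ≠ 0 := by
  have hG := h.generic.isInterpolation_interp (n := N + 1)
  induction α using composition_induction with
  | zero => rw [h.generic.interp_zero, map_one]; exact one_ne_zero
  | cyc α ih =>
    obtain ⟨c, hc⟩ := (hG α).exists_raise_eq_smul h.generic (hG (cyc α))
    have hraise := (hG α).eval_geom_raise h.generic h.a_ne_zero
    rw [hc, smul_eval] at hraise
    intro hzero
    rw [hzero, mul_zero, mul_zero, eq_comm, mul_eq_zero, ← neg_sub, neg_eq_zero] at hraise
    exact hraise.elim (h.one_sub_mul_bar_inv_ne_zero _ _) ih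
  | swap α i j hij ih =>
    by_cases hα : α i = α j
    · rwa [comp_swap_eq_self hα] at ih
    · have hβ : (α ∘ Equiv.swap i j) i ≠ (α ∘ Equiv.swap i j) j := by simpa using Ne.symm hα
      obtain ⟨e, he⟩ := (hG _).heckePoly_of_ne h.generic hij hβ (hG _)
      have hgeom := h.generic.eval_geom_interp_of_ne hij h.a_ne_zero he
      rw [comp_swap_comp_swap] at hgeom
      intro hzero
      rw [hzero, mul_zero] at hgeom
      exact mul_ne_zero (h.generic.heckeCoeff_bar_ne_zero hij (by exact_mod_cast hβ)) ih hgeom.symm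

/-- The value `K_α(y) = G_α(y) / G_α(aτ)` for a composition `α`. -/
def Kcomp (q t a : k) (α : Fin (N + 1) → ℕ) (y : Fin (N + 1) → k) : k :=
  (eval (geom t a) (interp q t α))⁻¹ * eval y (interp q t α)

theorem Generic.Kcomp_zero (h : Generic q t) (y : Fin (N + 1) → k) : Kcomp q t a 0 y = 1 := by
  rw [Kcomp, h.interp_zero, map_one, map_one, inv_one, mul_one]

theorem GenericParams.Kcomp_hecke (h : GenericParams q t a) (α : Fin (N + 1) → ℕ)
    {i j : Fin (N + 1)} (hij : (j : ℕ) = i + 1) {y : Fin (N + 1) → k} (hy : y i ≠ y j) :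
    heckeCoeff t i j y * (Kcomp q t a α (y ∘ Equiv.swap i j) - Kcomp q t a α y) =
      heckeCoeff t i j (node q t α) *
        (Kcomp q t a (α ∘ Equiv.swap i j) y - Kcomp q t a α y) := by
  have hG := h.generic.isInterpolation_interp (n := N + 1)
  by_cases hα : α i = α j
  · have hpoly := congrArg (eval y) ((hG α).heckePoly_of_eq h.generic hij hα)
    rw [eval_heckePoly t hy, smul_eval] at hpoly
    rw [comp_swap_eq_self hα, sub_self, mul_zero, Kcomp, Kcomp]
    linear_combination (eval (geom t a) (interp q t α))⁻¹ * hpoly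
  · obtain ⟨e, he⟩ := (hG α).heckePoly_of_ne h.generic hij hα (hG _)
    have hgeom := h.generic.eval_geom_interp_of_ne hij h.a_ne_zero he
    have hpoly := congrArg (eval y) he
    rw [eval_heckePoly t hy, map_add, smul_eval, smul_eval] at hpoly
    have hα' := h.eval_geom_interp_ne_zero (α ∘ Equiv.swap i j)
    have hratio : (eval (geom t a) (interp q t α))⁻¹ * e = heckeCoeff t i j (node q t α) *
        (eval (geom t a) (interp q t (α ∘ Equiv.swap i j)))⁻¹ := by
      rw [eq_mul_inv_iff_mul_eq₀ hα', mul_assoc, hgeom, mul_left_comm,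
        inv_mul_cancel₀ (h.eval_geom_interp_ne_zero α), mul_one]
    rw [Kcomp, Kcomp, Kcomp]
    linear_combination (eval (geom t a) (interp q t α))⁻¹ * hpoly +
      eval y (interp q t (α ∘ Equiv.swap i j)) * hratio

theorem GenericParams.Kcomp_rot (h : GenericParams q t a) (α : Fin (N + 1) → ℕ)
    (y : Fin (N + 1) → k) :
    (1 - t ^ N * y (Fin.last N)) * Kcomp q t a α (rot q y) =
      (1 - a * (node q t α 0)⁻¹) * Kcomp q t a (cyc α) y := by
  have hG := h.generic.isInterpolation_interp (n := N + 1)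
  obtain ⟨c, hc⟩ := (hG α).exists_raise_eq_smul h.generic (hG (cyc α))
  have hgeom := (hG α).eval_geom_raise h.generic h.a_ne_zero
  have hval := congrArg (eval y) hc
  rw [hc, smul_eval] at hgeom
  rw [eval_raise, smul_eval] at hval
  have hα := h.eval_geom_interp_ne_zero α
  have hα' := h.eval_geom_interp_ne_zero (cyc α)
  have hratio : (eval (geom t a) (interp q t α))⁻¹ * (t ^ N * c) =
      (a * (node q t α 0)⁻¹ - 1) * (eval (geom t a) (interp q t (cyc α)))⁻¹ := by
    rw [eq_mul_inv_iff_mul_eq₀ hα', mul_assoc, mul_assoc, hgeom, mul_left_comm,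
      inv_mul_cancel₀ hα, mul_one]
  have htN : t ^ N * t ^ (-(N : ℤ)) = 1 := by
    rw [zpow_neg, zpow_natCast, mul_inv_cancel₀ (pow_ne_zero N h.generic.t_ne_zero)]
  rw [Kcomp, Kcomp]
  linear_combination (-t ^ N * (eval (geom t a) (interp q t α))⁻¹) * hval -
    eval y (interp q t (cyc α)) * hratio -
    (eval (geom t a) (interp q t α))⁻¹ * eval (rot q y) (interp q t α) * htN

theorem GenericParams.Kcomp_geom_cyc (h : GenericParams q t a) (α : Fin (N + 1) → ℕ) {b : k}
    (hb : b ≠ 0) :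
    (1 - b * (node q t α 0)⁻¹) * Kcomp q t a α (geom t b) =
      (1 - a * (node q t α 0)⁻¹) * Kcomp q t a (cyc α) (geom t b) := by
  have hgeom := (h.generic.isInterpolation_interp α).eval_geom_raise h.generic hb
  have htN : t ^ N * t ^ (-(N : ℤ)) = 1 := by
    rw [zpow_neg, zpow_natCast, mul_inv_cancel₀ (pow_ne_zero N h.generic.t_ne_zero)]
  rw [eval_raise] at hgeom
  rw [← h.Kcomp_rot, Kcomp, Kcomp]
  linear_combination (eval (geom t a) (interp q t α))⁻¹ * (hgeom +
    eval (rot q (geom t b)) (interp q t α) * htN)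

theorem GenericParams.Kcomp_geom_swap (h : GenericParams q t a) (α : Fin (N + 1) → ℕ)
    {i j : Fin (N + 1)} (hij : (j : ℕ) = i + 1) {b : k} (hb : b ≠ 0) :
    Kcomp q t a (α ∘ Equiv.swap i j) (geom t b) = Kcomp q t a α (geom t b) := by
  by_cases hα : α i = α j
  · rw [comp_swap_eq_self hα]
  · have hne := h.generic.heckeCoeff_bar_ne_zero hij (v := fun l => (α l : ℤ))
      (by exact_mod_cast hα)
    have hecke := h.Kcomp_hecke α hij (h.generic.geom_ne hb hij)
    rw [heckeCoeff_eq_zero (geom_eq_mul h.generic.t_ne_zero b hij), zero_mul, eq_comm] at hecke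
    exact sub_eq_zero.1 ((mul_eq_zero.1 hecke).resolve_left hne)

theorem GenericParams.Kcomp_rot_iterate (h : GenericParams q t a) (m : ℕ)
    (α : Fin (N + 1) → ℕ) (y : Fin (N + 1) → k) :
    (∏ i ∈ Finset.range m, (1 - t ^ N * ((rot q)^[i] y) (Fin.last N))) *
        Kcomp q t a α ((rot q)^[m] y) =
      (∏ i ∈ Finset.range m, (1 - a * (bar q t (cyc^[i] fun i => (α i : ℤ)) 0)⁻¹)) *
        Kcomp q t a (cyc^[m] α) y := by
  induction m generalizing α with
  | zero => simp
  | succ m ih =>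
    rw [Finset.prod_range_succ, Finset.prod_range_succ', Function.iterate_succ_apply', mul_assoc,
      h.Kcomp_rot, mul_left_comm, ih, node, natCast_cyc]
    simp only [Function.iterate_succ_apply, Function.iterate_zero, id]
    ring

theorem GenericParams.Kcomp_add_one (h : GenericParams q t a) (α : Fin (N + 1) → ℕ)
    (y : Fin (N + 1) → k) :
    (∏ i, (1 - t ^ N * y i)) * Kcomp q t a α (fun i => q⁻¹ * y i) =
      (∏ i, (1 - a * (node q t α i)⁻¹)) * Kcomp q t a (fun i => α i + 1) y := by
  have hiter := h.Kcomp_rot_iterate (N + 1) α y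
  rw [rot_iterate_full, cyc_iterate_full, ← Fin.prod_univ_eq_prod_range,
    ← Fin.prod_univ_eq_prod_range] at hiter
  convert hiter using 2
  · rw [← Equiv.prod_comp Fin.revPerm]
    refine Finset.prod_congr rfl fun i _ => ?_
    have hrev : i.rev = ⟨Fin.last N - i, by omega⟩ := by
      ext
      simp [Fin.val_rev]
    rw [rot_iterate y i.isLt.le, if_pos (by simp; omega), Fin.revPerm_apply, hrev]
  · refine Finset.prod_congr rfl fun i _ => ?_
    rw [bar_cyc_iterate _ _ (by simpa using i.isLt)]
    simp

end Composition

theorem qPoch_succ {A : Type*} [CommRing A] (q z : A) (m : ℕ) :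
    qPoch q z (m + 1) = qPoch q z m * (1 - q ^ m * z) := by
  rw [qPoch, Finset.prod_range_succ, qPoch]

theorem qPoch_succ_left {A : Type*} [CommRing A] (q z : A) (m : ℕ) :
    qPoch q z (m + 1) = qPoch q (q * z) m * (1 - z) := by
  simp only [qPoch, Finset.prod_range_succ', pow_zero, one_mul, pow_succ, mul_assoc]

theorem shift_le {n : ℕ} {v : Fin n → ℤ} {m : ℕ} (hm : ∀ i, 0 ≤ v i + m) : shift v ≤ m :=
  Finset.sup_le fun i _ => by have := hm i; omega

section Shifted

variable {k : Type*} [Field k] {q t a : k} {N : ℕ}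

theorem rank_zero {n : ℕ} (i : Fin n) : rank (0 : Fin n → ℤ) i = i := by
  have hIio : (Finset.univ.filter fun j => j < i) = Finset.Iio i := by
    ext
    simp
  simp [rank, hIio]

theorem mul_bar_zero {n : ℕ} (b : k) (i : Fin n) :
    b * bar q t (0 : Fin n → ℤ) i = geom t b i := by
  rw [bar, rank_zero, Pi.zero_apply, zpow_zero, one_mul, geom]

/-- The points at which none of the denominators of the functions `K_v` vanishes. -/
def GenericPoint (q t : k) (y : Fin (N + 1) → k) : Prop :=
  ∀ (i : Fin (N + 1)) (j : ℤ), q ^ j * (t ^ N * y i) ≠ 1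

/-- The numerator of the factor `A_m(x; v)`. -/
def numer (q t a : k) (m : ℕ) {n : ℕ} (v : Fin n → ℤ) : k :=
  ∏ i, qPoch q (q * (a * (bar q t v i)⁻¹)) m

/-- The denominator of the factor `A_m(y; v)`. -/
def denom (q t : k) (m : ℕ) (y : Fin (N + 1) → k) : k :=
  ∏ i, qPoch q (q * (t ^ N * y i)) m

theorem denom_ne_zero {y : Fin (N + 1) → k} (hy : GenericPoint q t y) (m : ℕ) :
    denom q t m y ≠ 0 := by
  refine Finset.prod_ne_zero_iff.2 fun i _ => Finset.prod_ne_zero_iff.2 fun j _ hzero => ?_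
  refine hy i (j + 1 : ℕ) ?_
  rw [zpow_natCast, pow_succ, mul_assoc]
  exact (sub_eq_zero.1 hzero).symm

theorem numer_comp_swap (m : ℕ) {n : ℕ} (v : Fin n → ℤ) {i j : Fin n} (hij : (j : ℕ) = i + 1) :
    numer q t a m (v ∘ Equiv.swap i j) = numer q t a m v := by
  by_cases hv : v i = v j
  · rw [comp_swap_eq_self hv]
  · rw [numer, numer, bar_comp_swap v hij hv]
    exact Equiv.prod_comp (Equiv.swap i j) fun l => qPoch q (q * (a * (bar q t v l)⁻¹)) m

theorem denom_comp_perm (m : ℕ) (y : Fin (N + 1) → k) (σ : Equiv.Perm (Fin (N + 1))) :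
    denom q t m (y ∘ σ) = denom q t m y :=
  Equiv.prod_comp σ fun l => qPoch q (q * (t ^ N * y l)) m

theorem numer_cyc (hq : q ≠ 0) (m : ℕ) (v : Fin (N + 1) → ℤ) :
    numer q t a m (cyc v) * (1 - q ^ m * (a * (bar q t v 0)⁻¹)) =
      numer q t a m v * (1 - a * (bar q t v 0)⁻¹) := by
  have hlast : q * (a * (q * bar q t v 0)⁻¹) = a * (bar q t v 0)⁻¹ := by field_simp
  simp only [numer, Fin.prod_univ_castSucc (n := N) (f := fun i =>
    qPoch q (q * (a * (bar q t (cyc v) i)⁻¹)) m), Fin.prod_univ_succ, bar_cyc_last hq,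
    bar_cyc_castSucc, hlast]
  rw [mul_assoc, ← qPoch_succ, qPoch_succ_left]
  ring

theorem denom_rot (hq : q ≠ 0) (m : ℕ) (y : Fin (N + 1) → k) :
    denom q t m (rot q y) * (1 - q ^ m * (t ^ N * y (Fin.last N))) =
      denom q t m y * (1 - t ^ N * y (Fin.last N)) := by
  have hzero : q * (t ^ N * (q⁻¹ * y (Fin.last N))) = t ^ N * y (Fin.last N) := by field_simp
  rw [denom, denom, Fin.prod_univ_succ, Fin.prod_univ_castSucc (n := N)
    (f := fun i => qPoch q (q * (t ^ N * y i)) m)]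
  simp only [rot, Fin.cons_zero, Fin.cons_succ, hzero]
  rw [mul_right_comm, ← qPoch_succ, qPoch_succ_left]
  ring

theorem numer_succ (hq : q ≠ 0) (m : ℕ) {n : ℕ} (v : Fin n → ℤ) :
    numer q t a (m + 1) (fun i => v i + 1) =
      numer q t a m v * ∏ i, (1 - a * (bar q t v i)⁻¹) := by
  rw [numer, numer, ← Finset.prod_mul_distrib]
  refine Finset.prod_congr rfl fun i _ => ?_
  have hcancel : q * (a * (q * bar q t v i)⁻¹) = a * (bar q t v i)⁻¹ := by field_simp
  rw [bar_add_const hq, zpow_one, hcancel, qPoch_succ_left]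

theorem denom_succ (m : ℕ) (y : Fin (N + 1) → k) :
    denom q t (m + 1) y = denom q t m y * ∏ i, (1 - t ^ N * (q ^ (m + 1) * y i)) := by
  rw [denom, denom, ← Finset.prod_mul_distrib]
  refine Finset.prod_congr rfl fun i _ => ?_
  rw [qPoch_succ]
  ring

theorem numer_zero (ht : t ≠ 0) (m : ℕ) :
    numer q t a m (0 : Fin (N + 1) → ℤ) = denom q t m (geom t a : Fin (N + 1) → k) := by
  rw [numer, denom, ← Equiv.prod_comp Fin.revPerm]
  refine Finset.prod_congr rfl fun i _ => ?_
  have hpow : t ^ N * t ^ (-((i : ℕ) : ℤ)) = t ^ ((i.rev : ℕ) : ℤ) := by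
    rw [← zpow_natCast, ← zpow_add₀ ht, Fin.val_rev]
    congr 1
    omega
  rw [bar, rank_zero, Fin.revPerm_apply, Pi.zero_apply, zpow_zero, one_mul, ← zpow_neg, neg_neg,
    geom, mul_left_comm (t ^ N), hpow]

/-- The value `A_m(y; v) K_α(q^m y)`, where `α = v + (mⁿ)`. -/
def Kshift (q t a : k) (m : ℕ) (α : Fin (N + 1) → ℕ) (y : Fin (N + 1) → k) : k :=
  numer q t a m (fun i => (α i : ℤ)) / denom q t m y * Kcomp q t a α fun i => q ^ m * y i

theorem GenericParams.Kshift_hecke (h : GenericParams q t a) (m : ℕ) (α : Fin (N + 1) → ℕ)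
    {i j : Fin (N + 1)} (hij : (j : ℕ) = i + 1) {y : Fin (N + 1) → k} (hy : y i ≠ y j) :
    heckeCoeff t i j y * (Kshift q t a m α (y ∘ Equiv.swap i j) - Kshift q t a m α y) =
      heckeCoeff t i j (node q t α) *
        (Kshift q t a m (α ∘ Equiv.swap i j) y - Kshift q t a m α y) := by
  have hq := pow_ne_zero m h.generic.q_ne_zero
  have hK := h.Kcomp_hecke α hij (y := fun l => q ^ m * y l) ((mul_right_injective₀ hq).ne hy)
  have hnumer : numer q t a m (fun l => ((α ∘ Equiv.swap i j) l : ℤ)) =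
      numer q t a m fun l => (α l : ℤ) := numer_comp_swap m (fun l => (α l : ℤ)) hij
  rw [heckeCoeff_mul_left t hq] at hK
  rw [Kshift, Kshift, Kshift, denom_comp_perm, hnumer]
  simp only [Function.comp_def] at hK ⊢
  linear_combination (numer q t a m fun i => (α i : ℤ)) / denom q t m y * hK

theorem GenericParams.Kshift_rot (h : GenericParams q t a) (m : ℕ) (α : Fin (N + 1) → ℕ)
    {y : Fin (N + 1) → k} (hy : GenericPoint q t y) (hy' : GenericPoint q t (rot q y)) :
    (1 - t ^ N * y (Fin.last N)) * Kshift q t a m α (rot q y) =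
      (1 - q ^ m * (a * (node q t α 0)⁻¹)) * Kshift q t a m (cyc α) y := by
  have hK := h.Kcomp_rot α fun i => q ^ m * y i
  have hnumer := numer_cyc (t := t) (a := a) h.generic.q_ne_zero m fun i => (α i : ℤ)
  have hdenom : (1 - t ^ N * y (Fin.last N)) / denom q t m (rot q y) =
      (1 - q ^ m * (t ^ N * y (Fin.last N))) / denom q t m y := by
    rw [div_eq_div_iff (denom_ne_zero hy' m) (denom_ne_zero hy m)]
    linear_combination -denom_rot (t := t) h.generic.q_ne_zero m y
  rw [rot_mul_left] at hK
  rw [Kshift, Kshift, natCast_cyc]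
  linear_combination
    (numer q t a m (fun i => (α i : ℤ)) * Kcomp q t a α fun i => q ^ m * rot q y i) * hdenom +
    numer q t a m (fun i => (α i : ℤ)) / denom q t m y * hK -
    (denom q t m y)⁻¹ * Kcomp q t a (cyc α) (fun i => q ^ m * y i) * hnumer

theorem GenericParams.numer_mul_Kcomp_geom (h : GenericParams q t a) (m : ℕ)
    (α : Fin (N + 1) → ℕ) :
    numer q t a m (fun i => (α i : ℤ)) * Kcomp q t a α (geom t (q ^ m * a)) =
      denom q t m (geom t a : Fin (N + 1) → k) := by
  have hb : q ^ m * a ≠ 0 := mul_ne_zero (pow_ne_zero m h.generic.q_ne_zero) h.a_ne_zero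
  induction α using composition_induction with
  | zero =>
    rw [h.generic.Kcomp_zero, mul_one, ← numer_zero h.generic.t_ne_zero]
    rfl
  | cyc α ih =>
    have hK := h.Kcomp_geom_cyc α hb
    have hnumer := numer_cyc (t := t) (a := a) h.generic.q_ne_zero m fun i => (α i : ℤ)
    rw [← ih, natCast_cyc]
    refine mul_left_cancel₀ (h.one_sub_mul_bar_inv_ne_zero (fun i => (α i : ℤ)) 0) ?_
    rw [mul_assoc] at hK
    linear_combination (-numer q t a m (cyc fun i => (α i : ℤ))) * hK +
      Kcomp q t a α (geom t (q ^ m * a)) * hnumer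
  | swap α i j hij ih =>
    have hnumer := numer_comp_swap (q := q) (t := t) (a := a) m (fun l => (α l : ℤ)) hij
    rw [h.Kcomp_geom_swap α hij hb] at ih
    rw [← ih, ← hnumer]
    rfl

theorem GenericParams.Kshift_geom (h : GenericParams q t a) (m : ℕ) (α : Fin (N + 1) → ℕ)
    (hy : GenericPoint q t (geom t a : Fin (N + 1) → k)) : Kshift q t a m α (geom t a) = 1 := by
  have hgeom : (fun i : Fin (N + 1) => q ^ m * geom t a i) = geom t (q ^ m * a) :=
    funext fun i => (mul_assoc _ _ _).symm
  rw [Kshift, hgeom, div_mul_eq_mul_div, h.numer_mul_Kcomp_geom, div_self (denom_ne_zero hy m)]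

theorem GenericParams.Kshift_add_one (h : GenericParams q t a) (m : ℕ) (α : Fin (N + 1) → ℕ)
    {y : Fin (N + 1) → k} (hy : GenericPoint q t y) :
    Kshift q t a (m + 1) (fun i => α i + 1) y = Kshift q t a m α y := by
  have hq := h.generic.q_ne_zero
  have hK := h.Kcomp_add_one α fun i => q ^ (m + 1) * y i
  have hpow : (fun i => q⁻¹ * (q ^ (m + 1) * y i)) = fun i => q ^ m * y i := by
    ext i
    rw [pow_succ']
    field_simp
  have hdenom := denom_ne_zero hy (m + 1)
  rw [denom_succ] at hdenom
  rw [hpow] at hK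
  simp only [Kshift, Nat.cast_succ, numer_succ hq, denom_succ]
  rw [div_mul_eq_mul_div, mul_assoc, ← hK, mul_left_comm, mul_comm (denom q t m y),
    mul_div_mul_left _ _ (right_ne_zero_of_mul hdenom), div_mul_eq_mul_div]

/-- The value of `K_v` at `y`, for an integer vector `v`. -/
def Kval (q t a : k) (v : Fin (N + 1) → ℤ) (y : Fin (N + 1) → k) : k :=
  Kshift q t a (shift v) (fun i => (v i + shift v).toNat) y

theorem GenericParams.Kval_eq_Kshift (h : GenericParams q t a) {v : Fin (N + 1) → ℤ} {m : ℕ}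
    (hm : ∀ i, 0 ≤ v i + m) {y : Fin (N + 1) → k} (hy : GenericPoint q t y) :
    Kval q t a v y = Kshift q t a m (fun i => (v i + m).toNat) y := by
  obtain ⟨d, rfl⟩ := Nat.exists_eq_add_of_le (shift_le hm)
  clear hm
  induction d with
  | zero => rfl
  | succ d ih =>
    rw [ih, ← add_assoc, ← h.Kshift_add_one _ _ hy]
    congr 1
    ext i
    have := shift_nonneg v i
    push_cast
    omega

theorem node_toNat (hq : q ≠ 0) {n : ℕ} {v : Fin n → ℤ} {m : ℕ} (hm : ∀ i, 0 ≤ v i + m) :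
    node q t (fun i => (v i + m).toNat) = fun i => q ^ m * bar q t v i := by
  have hcast : (fun i => ((v i + m).toNat : ℤ)) = fun i => v i + m :=
    funext fun i => Int.toNat_of_nonneg (hm i)
  ext i
  rw [node, hcast, bar_add_const hq, zpow_natCast]

theorem cyc_toNat {v : Fin (N + 1) → ℤ} {m : ℕ} (hm : ∀ i, 0 ≤ v i + m) :
    cyc (fun i => (v i + m).toNat) = fun i => (cyc v i + m).toNat := by
  ext i
  cases i using Fin.lastCases with
  | last =>
    have := hm 0
    simp only [cyc_last]
    omega
  | cast i => simp only [cyc_castSucc]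

theorem GenericParams.Kval_hecke (h : GenericParams q t a) (v : Fin (N + 1) → ℤ)
    {i j : Fin (N + 1)} (hij : (j : ℕ) = i + 1) {y : Fin (N + 1) → k} (hy : y i ≠ y j)
    (hgen : GenericPoint q t y) :
    heckeCoeff t i j y * (Kval q t a v (y ∘ Equiv.swap i j) - Kval q t a v y) =
      heckeCoeff t i j (bar q t v) *
        (Kval q t a (v ∘ Equiv.swap i j) y - Kval q t a v y) := by
  have hm := shift_nonneg v
  have hK := h.Kshift_hecke (shift v) (fun i => (v i + shift v).toNat) hij hy
  rw [node_toNat h.generic.q_ne_zero hm,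
    heckeCoeff_mul_left t (pow_ne_zero _ h.generic.q_ne_zero)] at hK
  rw [h.Kval_eq_Kshift (v := v ∘ Equiv.swap i j) (m := shift v) (fun l => hm _) hgen]
  exact hK

theorem GenericParams.Kval_rot (h : GenericParams q t a) (v : Fin (N + 1) → ℤ)
    {y : Fin (N + 1) → k} (hy : GenericPoint q t y) (hy' : GenericPoint q t (rot q y)) :
    (1 - t ^ N * y (Fin.last N)) * Kval q t a v (rot q y) =
      (1 - a * (bar q t v 0)⁻¹) * Kval q t a (cyc v) y := by
  have hm := shift_nonneg v
  have hm' : ∀ i, 0 ≤ cyc v i + shift v := by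
    refine Fin.lastCases ?_ fun i => ?_
    · rw [cyc_last]
      have := hm 0
      omega
    · rw [cyc_castSucc]
      exact hm _
  have hK := h.Kshift_rot (shift v) (fun i => (v i + shift v).toNat) hy hy'
  rw [node_toNat h.generic.q_ne_zero hm, cyc_toNat hm, mul_inv, mul_left_comm a,
    mul_inv_cancel_left₀ (pow_ne_zero (shift v) h.generic.q_ne_zero)] at hK
  rw [h.Kval_eq_Kshift hm' hy]
  exact hK

theorem GenericParams.Kval_geom (h : GenericParams q t a) (v : Fin (N + 1) → ℤ)
    (hy : GenericPoint q t (geom t a : Fin (N + 1) → k)) : Kval q t a v (geom t a) = 1 :=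
  h.Kshift_geom _ _ hy

theorem Generic.Kval_zero (h : Generic q t) (y : Fin (N + 1) → k) : Kval q t a 0 y = 1 := by
  have hshift : shift (0 : Fin (N + 1) → ℤ) = 0 := Nat.le_zero.1 (shift_le (by simp))
  have hzero : (fun i : Fin (N + 1) => ((0 : Fin (N + 1) → ℤ) i + (0 : ℕ)).toNat) = 0 := by
    ext
    simp
  rw [Kval, hshift, Kshift, hzero, h.Kcomp_zero]
  simp [numer, denom, qPoch]

end Shifted

/-! ### Duality -/

theorem cyc_surjective {N : ℕ} : Function.Surjective (cyc : (Fin (N + 1) → ℤ) → _) := by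
  intro v
  refine ⟨Fin.cons (v (Fin.last N) - 1) fun i => v i.castSucc, ?_⟩
  ext i
  cases i using Fin.lastCases with
  | last => rw [cyc_last, Fin.cons_zero, sub_add_cancel]
  | cast i => rw [cyc_castSucc, Fin.cons_succ]

theorem lattice_induction {N : ℕ} {P : (Fin (N + 1) → ℤ) → Prop} (zero : P 0)
    (cyc : ∀ u, P u ↔ P (cyc u))
    (swap : ∀ u (i j : Fin (N + 1)), (j : ℕ) = i + 1 → P (u ∘ Equiv.swap i j) → P u)
    (u : Fin (N + 1) → ℤ) : P u := by
  have hcomp : ∀ α : Fin (N + 1) → ℕ, P fun i => (α i : ℤ) := by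
    intro α
    induction α using composition_induction with
    | zero => exact zero
    | cyc α ih => rwa [natCast_cyc, ← cyc]
    | swap α i j hij ih => exact swap _ i j hij ih
  have hiter : ∀ (m : ℕ) (u : Fin (N + 1) → ℤ), P u ↔ P (InterpMacdonald.cyc^[m] u) := by
    intro m
    induction m with
    | zero => exact fun u => Iff.rfl
    | succ m ih =>
      intro u
      rw [Function.iterate_succ_apply, ← ih, ← cyc]
  have hshift : ∀ (m : ℕ) (u : Fin (N + 1) → ℤ), P u ↔ P fun i => u i + m := by
    intro m
    induction m with
    | zero => simp
    | succ m ih =>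
      intro u
      rw [ih, hiter (N + 1), cyc_iterate_full]
      simp only [Nat.cast_succ, add_assoc]
  rw [hshift (shift u)]
  simpa only [Int.toNat_of_nonneg (shift_nonneg u _)] using hcomp fun i => (u i + shift u).toNat

section Duality

variable {k : Type*} [Field k] {q t a : k} {N : ℕ}

/-- The vector `-w₀v`. -/
def negRev {n : ℕ} (v : Fin n → ℤ) : Fin n → ℤ := fun i => -v i.rev

theorem cyc_negRev_cyc (v : Fin (N + 1) → ℤ) : cyc (negRev (cyc v)) = negRev v := by
  ext i
  cases i using Fin.lastCases with
  | last => rw [cyc_last, negRev, negRev, Fin.rev_zero, cyc_last, Fin.rev_last]; ring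
  | cast i => rw [cyc_castSucc, negRev, negRev, Fin.rev_succ, cyc_castSucc, Fin.rev_castSucc]

theorem rev_swap {n : ℕ} (i j l : Fin n) :
    (Equiv.swap i j l).rev = Equiv.swap i.rev j.rev l.rev := by
  simp only [Equiv.swap_apply_def, Fin.rev_inj]
  split_ifs <;> rfl

theorem negRev_comp_swap {n : ℕ} (v : Fin n → ℤ) (i j : Fin n) :
    negRev (v ∘ Equiv.swap i j) = negRev v ∘ Equiv.swap i.rev j.rev := by
  ext l
  simp only [negRev, Function.comp_apply, rev_swap, Fin.rev_rev]

/-- The point `aṽ`, where `ṽ` is the spectral point of `-w₀v`. -/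
def dualPoint {n : ℕ} (q t a : k) (v : Fin n → ℤ) : Fin n → k :=
  fun i => a * bar q t (negRev v) i

theorem GenericParams.genericPoint_mul_bar (h : GenericParams q t a) (v : Fin (N + 1) → ℤ) :
    GenericPoint q t fun i => a * bar q t v i := by
  intro i j
  convert h.a_mul_ne_one (j + v i) (N + -(rank v i : ℤ)) using 1
  rw [zpow_add₀ h.generic.q_ne_zero, zpow_add₀ h.generic.t_ne_zero, zpow_natCast]
  simp only [bar]
  ring

theorem rot_dualPoint (hq : q ≠ 0) (v : Fin (N + 1) → ℤ) :
    rot q (dualPoint q t a v) = dualPoint q t a (cyc v) := by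
  unfold dualPoint
  rw [rot_mul_left, ← cyc_negRev_cyc, rot_bar_cyc hq]

theorem dualPoint_zero {n : ℕ} : dualPoint q t a (0 : Fin n → ℤ) = geom t a := by
  have hzero : negRev (0 : Fin n → ℤ) = 0 := funext fun _ => neg_zero
  ext i
  rw [dualPoint, hzero, mul_bar_zero]

theorem dualPoint_last (ht : t ≠ 0) (v : Fin (N + 1) → ℤ) :
    t ^ N * dualPoint q t a v (Fin.last N) = a * (bar q t v 0)⁻¹ := by
  have hexp : 1 - ((N + 1 : ℕ) : ℤ) = -(N : ℤ) := by
    push_cast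
    ring
  unfold dualPoint negRev
  rw [bar_neg_rev ht, Fin.rev_last, hexp, zpow_neg, zpow_natCast]
  field_simp

theorem GenericParams.Kval_dualPoint_cyc (h : GenericParams q t a) (u v : Fin (N + 1) → ℤ) :
    (1 - a * (bar q t v 0)⁻¹) * Kval q t a u (dualPoint q t a (cyc v)) =
      (1 - a * (bar q t u 0)⁻¹) * Kval q t a (cyc u) (dualPoint q t a v) := by
  have hrot := rot_dualPoint (t := t) (a := a) h.generic.q_ne_zero v
  rw [← dualPoint_last h.generic.t_ne_zero, ← hrot]
  exact h.Kval_rot u (h.genericPoint_mul_bar _) (hrot ▸ h.genericPoint_mul_bar _)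

theorem heckeCoeff_bar_negRev (hq : q ≠ 0) (ht : t ≠ 0) {n : ℕ} (v : Fin n → ℤ) (i j : Fin n) :
    heckeCoeff t i j (bar q t (negRev v)) = heckeCoeff t j.rev i.rev (bar q t v) := by
  have hbar : bar q t (negRev v) = fun i => t ^ (1 - (n : ℤ)) * (bar q t v i.rev)⁻¹ :=
    funext (bar_neg_rev ht v)
  rw [hbar, heckeCoeff_mul_left t (zpow_ne_zero _ ht)]
  exact heckeCoeff_inv t (y := fun l => bar q t v l.rev) (bar_ne_zero hq ht v _)
    (bar_ne_zero hq ht v _)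

theorem GenericParams.Kval_dualPoint_hecke (h : GenericParams q t a) (u v : Fin (N + 1) → ℤ)
    {i j : Fin (N + 1)} (hij : (j : ℕ) = i + 1) :
    heckeCoeff t j.rev i.rev (bar q t v) *
      (Kval q t a u (dualPoint q t a (v ∘ Equiv.swap j.rev i.rev)) -
        Kval q t a u (dualPoint q t a v)) =
      heckeCoeff t i j (bar q t u) *
        (Kval q t a (u ∘ Equiv.swap i j) (dualPoint q t a v) -
          Kval q t a u (dualPoint q t a v)) := by
  have hne : dualPoint q t a v i ≠ dualPoint q t a v j :=
    (mul_right_injective₀ h.a_ne_zero).ne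
      ((h.generic.bar_injective _).ne (ne_of_val_eq_succ hij))
  have hK := h.Kval_hecke u hij hne (h.genericPoint_mul_bar _)
  have hswap := heckeCoeff_bar_mul_comp_swap (q := q) h.generic.t_ne_zero
    (fun y => Kval q t a u fun l => a * y l) (negRev v) hij
  have hrev : negRev v ∘ Equiv.swap i j = negRev (v ∘ Equiv.swap j.rev i.rev) := by
    rw [negRev_comp_swap, Fin.rev_rev, Fin.rev_rev, Equiv.swap_comm]
  unfold dualPoint at hK ⊢
  rw [heckeCoeff_mul_left t h.a_ne_zero] at hK
  rw [hrev, heckeCoeff_bar_negRev h.generic.q_ne_zero h.generic.t_ne_zero] at hswap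
  rw [heckeCoeff_bar_negRev h.generic.q_ne_zero h.generic.t_ne_zero] at hK
  rw [← hK, mul_sub, mul_sub, ← hswap]
  rfl

/-- Both sides satisfy the same recursions in `u` and `v`. -/
theorem GenericParams.Kval_dualPoint_symm (h : GenericParams q t a) (u v : Fin (N + 1) → ℤ) :
    Kval q t a u (dualPoint q t a v) = Kval q t a v (dualPoint q t a u) := by
  induction u using lattice_induction generalizing v with
  | zero =>
    have hgen := h.genericPoint_mul_bar (negRev (0 : Fin (N + 1) → ℤ))
    rw [h.generic.Kval_zero, dualPoint_zero, h.Kval_geom v (dualPoint_zero (q := q) ▸ hgen)]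
  | cyc u =>
    constructor <;> intro ih v
    · refine mul_left_cancel₀ (h.one_sub_mul_bar_inv_ne_zero u 0) ?_
      rw [← h.Kval_dualPoint_cyc, ih, h.Kval_dualPoint_cyc]
    · obtain ⟨w, rfl⟩ := cyc_surjective v
      refine mul_left_cancel₀ (h.one_sub_mul_bar_inv_ne_zero w 0) ?_
      rw [h.Kval_dualPoint_cyc, ih, h.Kval_dualPoint_cyc]
  | swap u i j hij ih =>
    by_cases hu : u i = u j
    · rw [comp_swap_eq_self hu] at ih
      exact ih v
    have hij' : (i.rev : ℕ) = j.rev + 1 := by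
      simp only [Fin.val_rev]
      omega
    have hne := h.generic.heckeCoeff_bar_ne_zero hij (v := u ∘ Equiv.swap i j)
      (by simpa using Ne.symm hu)
    have hleft := h.Kval_dualPoint_hecke (u ∘ Equiv.swap i j) v hij
    have hright := h.Kval_dualPoint_hecke v (u ∘ Equiv.swap i j) hij'
    rw [Fin.rev_rev, Fin.rev_rev, comp_swap_comp_swap, ← ih, ← ih] at hright
    rw [comp_swap_comp_swap] at hleft
    exact sub_left_injective (mul_left_cancel₀ hne (hleft.symm.trans hright.symm))

end Duality

/-! ### Values of rational functions -/

section Values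

variable {k : Type*} [Field k] {n : ℕ}

/-- `f` is regular at `y` with value `c`. -/
def HasVal (f : RatField k n) (y : Fin n → k) (c : k) : Prop :=
  ∃ p d : MvPolynomial (Fin n) k, eval y d ≠ 0 ∧
    f = algebraMap _ (RatField k n) p / algebraMap _ (RatField k n) d ∧
    eval y p / eval y d = c

theorem HasVal.isRegularAt {f : RatField k n} {y : Fin n → k} {c : k} (h : HasVal f y c) :
    IsRegularAt f y := by
  obtain ⟨p, d, hd, hf, -⟩ := h
  exact ⟨p, d, hd, hf⟩

theorem IsRegularAt.hasVal {f : RatField k n} {y : Fin n → k} (h : IsRegularAt f y) :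
    ∃ c, HasVal f y c := by
  obtain ⟨p, d, hd, hf⟩ := h
  exact ⟨_, p, d, hd, hf, rfl⟩

theorem HasVal.value_eq {f : RatField k n} {y : Fin n → k} {c : k} (h : HasVal f y c) :
    value f y = c := by
  obtain ⟨p, d, hd, rfl, rfl⟩ := h
  exact value_div y p d hd

theorem algebraMap_ne_zero_of_eval {y : Fin n → k} {d : MvPolynomial (Fin n) k}
    (hd : eval y d ≠ 0) : algebraMap _ (RatField k n) d ≠ 0 := by
  rw [map_ne_zero_iff _ (IsFractionRing.injective (MvPolynomial (Fin n) k) (RatField k n))]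
  rintro rfl
  exact hd (map_zero _)

theorem hasVal_algebraMap (p : MvPolynomial (Fin n) k) (y : Fin n → k) :
    HasVal (algebraMap _ (RatField k n) p) y (eval y p) :=
  ⟨p, 1, by simp, by simp, by simp⟩

theorem hasVal_const (c : k) (y : Fin n → k) : HasVal (algebraMap k (RatField k n) c) y c := by
  rw [IsScalarTower.algebraMap_apply k (MvPolynomial (Fin n) k) (RatField k n)]
  simpa [algebraMap_eq] using
    hasVal_algebraMap (algebraMap k (MvPolynomial (Fin n) k) c) y

theorem hasVal_one (y : Fin n → k) : HasVal (1 : RatField k n) y 1 := by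
  simpa using hasVal_algebraMap 1 y

theorem hasVal_var (i : Fin n) (y : Fin n → k) : HasVal (var i) y (y i) := by
  have h := hasVal_algebraMap (X i) y
  rwa [eval_X] at h

theorem HasVal.add {f f' : RatField k n} {y : Fin n → k} {c c' : k} (h : HasVal f y c)
    (h' : HasVal f' y c') : HasVal (f + f') y (c + c') := by
  obtain ⟨p, d, hd, rfl, rfl⟩ := h
  obtain ⟨p', d', hd', rfl, rfl⟩ := h'
  refine ⟨p * d' + d * p', d * d', by simp [hd, hd'], ?_, ?_⟩
  · rw [div_add_div _ _ (algebraMap_ne_zero_of_eval hd) (algebraMap_ne_zero_of_eval hd')]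
    simp only [map_add, map_mul]
  · rw [div_add_div _ _ hd hd']
    simp only [map_add, map_mul]

theorem HasVal.mul {f f' : RatField k n} {y : Fin n → k} {c c' : k} (h : HasVal f y c)
    (h' : HasVal f' y c') : HasVal (f * f') y (c * c') := by
  obtain ⟨p, d, hd, rfl, rfl⟩ := h
  obtain ⟨p', d', hd', rfl, rfl⟩ := h'
  exact ⟨p * p', d * d', by simp [hd, hd'], by simp only [map_mul, div_mul_div_comm],
    by simp only [map_mul, div_mul_div_comm]⟩

theorem HasVal.neg {f : RatField k n} {y : Fin n → k} {c : k} (h : HasVal f y c) :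
    HasVal (-f) y (-c) := by
  obtain ⟨p, d, hd, rfl, rfl⟩ := h
  exact ⟨-p, d, hd, by simp only [map_neg, neg_div], by simp only [map_neg, neg_div]⟩

theorem HasVal.sub {f f' : RatField k n} {y : Fin n → k} {c c' : k} (h : HasVal f y c)
    (h' : HasVal f' y c') : HasVal (f - f') y (c - c') := by
  rw [sub_eq_add_neg, sub_eq_add_neg]
  exact h.add h'.neg

theorem HasVal.inv {f : RatField k n} {y : Fin n → k} {c : k} (h : HasVal f y c)
    (hc : c ≠ 0) : HasVal f⁻¹ y c⁻¹ := by
  obtain ⟨p, d, -, rfl, rfl⟩ := h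
  exact ⟨d, p, fun hp => hc (by rw [hp, zero_div]), inv_div _ _, (inv_div _ _).symm⟩

theorem HasVal.div {f f' : RatField k n} {y : Fin n → k} {c c' : k} (h : HasVal f y c)
    (h' : HasVal f' y c') (hc : c' ≠ 0) : HasVal (f / f') y (c / c') := by
  rw [div_eq_mul_inv, div_eq_mul_inv]
  exact h.mul (h'.inv hc)

theorem HasVal.prod {ι : Type*} (s : Finset ι) {f : ι → RatField k n} {y : Fin n → k}
    {c : ι → k} (h : ∀ i ∈ s, HasVal (f i) y (c i)) :
    HasVal (∏ i ∈ s, f i) y (∏ i ∈ s, c i) := by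
  classical
  induction s using Finset.induction_on with
  | empty => simpa using hasVal_one y
  | insert i s hi ih =>
    rw [Finset.prod_insert hi, Finset.prod_insert hi]
    exact (h i (Finset.mem_insert_self _ _)).mul
      (ih fun j hj => h j (Finset.mem_insert_of_mem hj))

theorem permAct_algebraMap (w : Equiv.Perm (Fin n)) (p : MvPolynomial (Fin n) k) :
    permAct w (algebraMap _ (RatField k n) p) =
      algebraMap _ (RatField k n) (rename w p) := by
  simp [permAct, IsFractionRing.map]

theorem scale_algebraMap (c : kˣ) (p : MvPolynomial (Fin n) k) :
    scale c (algebraMap _ (RatField k n) p) = algebraMap _ (RatField k n) (scalePoly c p) := by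
  simp [scale, IsFractionRing.map]

theorem coeffAct_algebraMap (σ : k →+* k) (p : MvPolynomial (Fin n) k) :
    coeffAct σ (algebraMap _ (RatField k n) p) =
      algebraMap _ (RatField k n) (map σ p) := by
  simp [coeffAct, IsFractionRing.map]

theorem eval_scalePoly (b : kˣ) (y : Fin n → k) (p : MvPolynomial (Fin n) k) :
    eval y (scalePoly b p) = eval (fun i => (b : k) * y i) p := by
  refine (eval₂Hom_bind₁ _ _ _ _).trans (congrArg (eval · p) ?_)
  ext i
  simp only [map_mul, eval₂Hom_C, eval₂Hom_X', RingHom.id_apply]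

theorem HasVal.permAct {f : RatField k n} {y : Fin n → k} {c : k} (w : Equiv.Perm (Fin n))
    (h : HasVal f (y ∘ w) c) : HasVal (permAct w f) y c := by
  obtain ⟨p, d, hd, rfl, rfl⟩ := h
  exact ⟨rename w p, rename w d, by rwa [eval_rename],
    by rw [map_div₀, permAct_algebraMap, permAct_algebraMap], by rw [eval_rename, eval_rename]⟩

theorem HasVal.scale {f : RatField k n} {y : Fin n → k} {c : k} (b : kˣ)
    (h : HasVal f (fun i => (b : k) * y i) c) : HasVal (scale b f) y c := by
  obtain ⟨p, d, hd, rfl, rfl⟩ := h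
  exact ⟨scalePoly b p, scalePoly b d, by rwa [eval_scalePoly],
    by rw [map_div₀, scale_algebraMap, scale_algebraMap],
    by rw [eval_scalePoly, eval_scalePoly]⟩

theorem HasVal.coeffAct {f : RatField k n} {y : Fin n → k} {c : k} (σ : k →+* k)
    (h : HasVal f y c) : HasVal (coeffAct σ f) (σ ∘ y) (σ c) := by
  obtain ⟨p, d, hd, rfl, rfl⟩ := h
  refine ⟨map σ p, map σ d, ?_, ?_, ?_⟩
  · rwa [← map_eval, map_ne_zero]
  · rw [map_div₀, coeffAct_algebraMap, coeffAct_algebraMap]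
  · rw [← map_eval, ← map_eval, map_div₀]

theorem hasVal_qPoch (q c : k) (i : Fin n) (m : ℕ) (y : Fin n → k) :
    HasVal (qPoch (algebraMap k (RatField k n) q) (algebraMap k (RatField k n) c * var i) m) y
      (qPoch q (c * y i) m) := by
  refine HasVal.prod _ fun j _ => (hasVal_one y).sub (HasVal.mul ?_
    ((hasVal_const c y).mul (hasVal_var i y)))
  rw [← map_pow]
  exact hasVal_const _ y

end Values

/-! ### Braid relations and the longest word -/

section Braid

/-- The Demazure–Lusztig operator `T + (x - T y) / (x - y) · (σ - 1)` of a field endomorphism `σ`;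
`heckeOp` is the case where `σ` exchanges two neighbouring variables `x` and `y`. -/
def demazureLusztig {L : Type*} [Field L] (σ : L →+* L) (T x y f : L) : L :=
  T * f + (x - T * y) / (x - y) * (σ f - f)

theorem demazureLusztig_braid {L : Type*} [Field L] {σ₁ σ₂ : L →+* L}
    (hσ₁ : Function.Involutive σ₁) (hσ₂ : Function.Involutive σ₂)
    (hbraid : ∀ f, σ₁ (σ₂ (σ₁ f)) = σ₂ (σ₁ (σ₂ f))) {T x₁ x₂ x₃ : L}
    (hT₁ : σ₁ T = T) (hT₂ : σ₂ T = T) (h₁₂ : σ₁ x₁ = x₂) (h₂₃ : σ₂ x₂ = x₃)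
    (h₃ : σ₁ x₃ = x₃) (h₁ : σ₂ x₁ = x₁) (hx₁₂ : x₁ ≠ x₂) (hx₂₃ : x₂ ≠ x₃) (hx₁₃ : x₁ ≠ x₃)
    (f : L) :
    demazureLusztig σ₁ T x₁ x₂ (demazureLusztig σ₂ T x₂ x₃ (demazureLusztig σ₁ T x₁ x₂ f)) =
      demazureLusztig σ₂ T x₂ x₃
        (demazureLusztig σ₁ T x₁ x₂ (demazureLusztig σ₂ T x₂ x₃ f)) := by
  have h₂₁ : σ₁ x₂ = x₁ := by rw [← h₁₂, hσ₁]
  have h₃₂ : σ₂ x₃ = x₂ := by rw [← h₂₃, hσ₂]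
  have hsub₁₂ := sub_ne_zero.2 hx₁₂
  have hsub₂₃ := sub_ne_zero.2 hx₂₃
  have hsub₁₃ := sub_ne_zero.2 hx₁₃
  simp only [demazureLusztig, map_add, map_mul, map_sub, map_div₀, hT₁, hT₂, h₁₂, h₂₁, h₂₃, h₃₂,
    h₃, h₁, hσ₁ _, hσ₂ _, hbraid]
  rw [← neg_sub x₁ x₂, ← neg_sub x₂ x₃]
  field_simp
  ring

theorem demazureLusztig_comm {L : Type*} [Field L] {σ₁ σ₂ : L →+* L}
    (hcomm : ∀ f, σ₁ (σ₂ f) = σ₂ (σ₁ f)) {T x₁ y₁ x₂ y₂ : L} (hT₁ : σ₁ T = T) (hT₂ : σ₂ T = T)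
    (hx₂ : σ₁ x₂ = x₂) (hy₂ : σ₁ y₂ = y₂) (hx₁ : σ₂ x₁ = x₁) (hy₁ : σ₂ y₁ = y₁) (f : L) :
    demazureLusztig σ₁ T x₁ y₁ (demazureLusztig σ₂ T x₂ y₂ f) =
      demazureLusztig σ₂ T x₂ y₂ (demazureLusztig σ₁ T x₁ y₁ f) := by
  simp only [demazureLusztig, map_add, map_mul, map_sub, map_div₀, hT₁, hT₂, hx₂, hy₂, hx₁, hy₁,
    hcomm]
  ring

variable {k : Type*} [Field k] {n : ℕ}

theorem heckeOp_eq_demazureLusztig (t : k) (i : Fin (n - 1)) (f : RatField k n) :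
    heckeOp t i f =
      demazureLusztig (permAct (simple i)) (algebraMap k _ t) (var (lft i)) (var (rgt i)) f :=
  rfl

theorem permAct_mul (w w' : Equiv.Perm (Fin n)) (f : RatField k n) :
    permAct (w * w') f = permAct w (permAct w' f) := by
  obtain ⟨p, d, -, rfl⟩ := IsFractionRing.div_surjective (A := MvPolynomial (Fin n) k) f
  simp only [map_div₀, permAct_algebraMap, rename_rename]
  rfl

theorem permAct_one (f : RatField k n) : permAct (1 : Equiv.Perm (Fin n)) f = f := by
  obtain ⟨p, d, -, rfl⟩ := IsFractionRing.div_surjective (A := MvPolynomial (Fin n) k) f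
  simp only [map_div₀, permAct_algebraMap, Equiv.Perm.coe_one, rename_id, AlgHom.id_apply]

theorem var_injective : Function.Injective (var : Fin n → RatField k n) :=
  (IsFractionRing.injective (MvPolynomial (Fin n) k) (RatField k n)).comp X_injective

theorem lft_ne_rgt (i : Fin (n - 1)) : lft i ≠ rgt i := by
  simp [lft, rgt]

theorem lft_ne_rgt_succ {i j : Fin (n - 1)} (hij : (j : ℕ) = i + 1) : lft i ≠ rgt j := by
  simp only [lft, rgt, ne_eq, Fin.mk.injEq]
  omega

theorem simple_lft (i : Fin (n - 1)) : simple i (lft i) = rgt i :=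
  Equiv.swap_apply_left _ _

theorem simple_apply_of_ne {i : Fin (n - 1)} {j : Fin n} (hl : (j : ℕ) ≠ i)
    (hr : (j : ℕ) ≠ i + 1) : simple i j = j := by
  ext
  rw [simple_val, if_neg hl, if_neg hr]

theorem permAct_simple_involutive (i : Fin (n - 1)) :
    Function.Involutive (permAct (simple i) : RatField k n → RatField k n) := fun f => by
  rw [← permAct_mul, simple, Equiv.swap_mul_self, permAct_one]

theorem simple_braid {i j : Fin (n - 1)} (hij : (j : ℕ) = i + 1) :
    simple i * simple j * simple i = simple j * simple i * simple j := by
  have hlft : lft j = rgt i := Fin.ext hij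
  have hl := lft_ne_rgt i
  have hr : rgt i ≠ rgt j := hlft ▸ lft_ne_rgt j
  have hlr := lft_ne_rgt_succ hij
  rw [simple, simple, hlft, Equiv.swap_mul_swap_mul_swap hl hlr,
    Equiv.swap_comm (lft i) (rgt i), Equiv.swap_comm (rgt i) (rgt j),
    Equiv.swap_mul_swap_mul_swap hr.symm hlr.symm, Equiv.swap_comm]

theorem simple_comm {i j : Fin (n - 1)} (hij : (i : ℕ) + 2 ≤ j) :
    simple i * simple j = simple j * simple i := by
  have hl : simple i (lft j) = lft j := by
    apply simple_apply_of_ne <;> simp only [lft] <;> omega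
  have hr : simple i (rgt j) = rgt j := by
    apply simple_apply_of_ne <;> simp only [rgt] <;> omega
  rw [simple.eq_1 j, Equiv.mul_swap_eq_swap_mul, hl, hr]

theorem heckeOp_braid (t : k) {i j : Fin (n - 1)} (hij : (j : ℕ) = i + 1) (f : RatField k n) :
    heckeOp t i (heckeOp t j (heckeOp t i f)) = heckeOp t j (heckeOp t i (heckeOp t j f)) := by
  have hlft : lft j = rgt i := Fin.ext hij
  have hsimple (g : RatField k n) :
      permAct (simple i) (permAct (simple j) (permAct (simple i) g)) =
        permAct (simple j) (permAct (simple i) (permAct (simple j) g)) := by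
    rw [← permAct_mul, ← permAct_mul, ← permAct_mul, ← permAct_mul, simple_braid hij]
  have hlr : permAct (simple i) (var (lft i) : RatField k n) = var (rgt i) := by
    rw [permAct_var, simple_lft]
  have hrr : permAct (simple j) (var (rgt i) : RatField k n) = var (rgt j) := by
    rw [permAct_var, ← hlft, simple_lft]
  have hfixr : permAct (simple i) (var (rgt j) : RatField k n) = var (rgt j) := by
    rw [permAct_var, simple_apply_of_ne] <;> simp only [rgt] <;> omega
  have hfixl : permAct (simple j) (var (lft i) : RatField k n) = var (lft i) := by
    rw [permAct_var, simple_apply_of_ne] <;> simp only [lft] <;> omega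
  have hvar : (var (rgt i) : RatField k n) ≠ var (rgt j) :=
    var_injective.ne (hlft ▸ lft_ne_rgt j)
  have hbraid := demazureLusztig_braid (L := RatField k n) (permAct_simple_involutive i)
    (permAct_simple_involutive j) hsimple (permAct_const _ t) (permAct_const _ t) hlr hrr hfixr
    hfixl (var_injective.ne (lft_ne_rgt i)) hvar (var_injective.ne (lft_ne_rgt_succ hij)) f
  simpa only [heckeOp_eq_demazureLusztig, hlft] using hbraid

theorem heckeOp_comm (t : k) {i j : Fin (n - 1)} (hij : (i : ℕ) + 2 ≤ j) (f : RatField k n) :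
    heckeOp t i (heckeOp t j f) = heckeOp t j (heckeOp t i f) := by
  simp only [heckeOp_eq_demazureLusztig]
  refine demazureLusztig_comm (fun f => ?_) (permAct_const _ _) (permAct_const _ _)
    ?_ ?_ ?_ ?_ f
  · rw [← permAct_mul, ← permAct_mul, simple_comm hij]
  all_goals
    rw [permAct_var, simple_apply_of_ne] <;> simp only [lft, rgt] <;> omega

end Braid

section Words

/-- The word `s + c - 1, …, s + 1, s`. -/
def descList (s : ℕ) : ℕ → List ℕ
  | 0 => []
  | c + 1 => (s + c) :: descList s c

/-- The word `(0)(1, 0) ⋯ (c - 1, …, 0)` of indices underlying `stairWord`. -/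
def stairList : ℕ → List ℕ
  | 0 => []
  | c + 1 => stairList c ++ descList 0 (c + 1)

/-- The word `(s + c - 1, …, s)(s + c - 1, …, s + 1) ⋯ (s + c - 1)`: for `s = 0`, the reverse of
the image of `stairList c` under `i ↦ c - 1 - i`. -/
def veeList : ℕ → ℕ → List ℕ
  | _, 0 => []
  | s, c + 1 => descList s (c + 1) ++ veeList (s + 1) c

theorem descList_succ' (s c : ℕ) : descList s (c + 1) = descList (s + 1) c ++ [s] := by
  induction c with
  | zero => rfl
  | succ c ih =>
    rw [descList, ih, descList, List.cons_append, add_right_comm, add_assoc]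

theorem map_succ_descList (s c : ℕ) : (descList s c).map (· + 1) = descList (s + 1) c := by
  induction c with
  | zero => rfl
  | succ c ih => rw [descList, List.map_cons, ih, descList, add_right_comm]

theorem map_succ_veeList (s c : ℕ) : (veeList s c).map (· + 1) = veeList (s + 1) c := by
  induction c generalizing s with
  | zero => rfl
  | succ c ih => rw [veeList, List.map_append, ih, map_succ_descList, veeList]

theorem lt_of_mem_descList {s c i : ℕ} (h : i ∈ descList s c) : i < s + c := by
  induction c with
  | zero => simp [descList] at h
  | succ c ih =>
    rcases List.mem_cons.1 h with rfl | hmem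
    · omega
    · exact (ih hmem).trans (by omega)

theorem lt_of_mem_veeList {s c i : ℕ} (h : i ∈ veeList s c) : i < s + c := by
  induction c generalizing s with
  | zero => simp [veeList] at h
  | succ c ih =>
    rcases List.mem_append.1 h with hmem | hmem
    · exact lt_of_mem_descList hmem
    · exact (ih hmem).trans_eq (by omega)

theorem reverse_map_descList (s c : ℕ) :
    ((descList 0 c).map fun i => s + c - 1 - i).reverse = descList s c := by
  induction c generalizing s with
  | zero => rfl
  | succ c ih =>
    have hhead : s + (c + 1) - 1 - c = s := by omega
    have hflip : (fun i => s + (c + 1) - 1 - i) = fun i => s + 1 + c - 1 - i := by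
      ext i
      omega
    rw [descList, List.map_cons, List.reverse_cons, descList_succ', ← ih (s + 1), zero_add,
      hhead, hflip]

theorem reverse_map_stairList (s c : ℕ) :
    ((stairList c).map fun i => s + c - 1 - i).reverse = veeList s c := by
  induction c generalizing s with
  | zero => rfl
  | succ c ih =>
    have hflip : (fun i => s + (c + 1) - 1 - i) = fun i => s + 1 + c - 1 - i := by
      ext i
      omega
    rw [stairList, List.map_append, List.reverse_append, reverse_map_descList, veeList, ← ih,
      hflip]

theorem map_val_descWord (n m : ℕ) (h : m ≤ n - 1) :
    (descWord n m h).map Fin.val = descList 0 m := by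
  induction m with
  | zero => rfl
  | succ m ih => rw [descWord, List.map_cons, ih, descList, zero_add]

theorem map_val_stairWord (n m : ℕ) (h : m ≤ n - 1) :
    (stairWord n m h).map Fin.val = stairList m := by
  induction m with
  | zero => rfl
  | succ m ih => rw [stairWord, List.map_append, ih, map_val_descWord, stairList]

theorem map_val_longWord (n : ℕ) : (longWord n).map Fin.val = stairList (n - 1) :=
  map_val_stairWord n _ le_rfl

theorem map_val_reverse_map_rev_longWord (n : ℕ) :
    ((longWord n).map Fin.rev).reverse.map Fin.val = veeList 0 (n - 1) := by
  have hrev : Fin.val ∘ Fin.rev = (fun i => 0 + (n - 1) - 1 - i) ∘ (Fin.val : Fin (n - 1) → ℕ) := by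
    ext i
    simp only [Function.comp_apply, Fin.val_rev]
    omega
  rw [← reverse_map_stairList, ← map_val_longWord, List.map_reverse, List.map_map, List.map_map,
    hrev]

end Words

section BraidMonoid

/-- The braid relations between `T 0, …, T (m - 1)`. -/
structure BraidRelations {M : Type*} [Monoid M] (T : ℕ → M) (m : ℕ) : Prop where
  comm : ∀ i j, i + 2 ≤ j → j < m → T i * T j = T j * T i
  braid : ∀ i, i + 1 < m → T i * T (i + 1) * T i = T (i + 1) * T i * T (i + 1)

variable {M : Type*} [Monoid M] {T : ℕ → M} {m : ℕ}

theorem prod_descList_succ (T : ℕ → M) (c : ℕ) :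
    ((descList 0 (c + 1)).map T).prod = T c * ((descList 0 c).map T).prod := by
  rw [descList, List.map_cons, List.prod_cons, zero_add]

theorem BraidRelations.prod_descList_mul (h : BraidRelations T m) {c j : ℕ} (hcj : c < j)
    (hj : j < m) :
    ((descList 0 c).map T).prod * T j = T j * ((descList 0 c).map T).prod := by
  induction c with
  | zero => rw [descList, List.map_nil, List.prod_nil, one_mul, mul_one]
  | succ c ih =>
    rw [prod_descList_succ, mul_assoc, ih (by omega), ← mul_assoc, h.comm c j hcj hj, mul_assoc]

theorem BraidRelations.mul_prod_descList (h : BraidRelations T m) {c i : ℕ} (hic : i < c)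
    (hc : c < m) :
    T i * ((descList 0 (c + 1)).map T).prod =
      ((descList 0 (c + 1)).map T).prod * T (i + 1) := by
  induction c with
  | zero => omega
  | succ c ih =>
    rw [prod_descList_succ]
    rcases Nat.lt_succ_iff_lt_or_eq.1 hic with hlt | rfl
    · rw [← mul_assoc, h.comm i (c + 1) (by omega) hc, mul_assoc, ih hlt (by omega), mul_assoc]
    · simp only [prod_descList_succ, mul_assoc, h.prod_descList_mul i.lt_succ_self hc]
      simp only [← mul_assoc, h.braid i hc]

theorem BraidRelations.prod_mul_prod_descList (h : BraidRelations T m) {c : ℕ} (hc : c < m)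
    {L : List ℕ} (hL : ∀ i ∈ L, i < c) :
    (L.map T).prod * ((descList 0 (c + 1)).map T).prod =
      ((descList 0 (c + 1)).map T).prod * ((L.map (· + 1)).map T).prod := by
  induction L with
  | nil => simp only [List.map_nil, List.prod_nil, one_mul, mul_one]
  | cons i L ih =>
    rw [List.map_cons, List.prod_cons, mul_assoc, ih fun j hj => hL j (List.mem_cons_of_mem _ hj),
      ← mul_assoc, h.mul_prod_descList (hL i List.mem_cons_self) hc, mul_assoc, List.map_cons,
      List.map_cons, List.prod_cons]

theorem BraidRelations.prod_stairList (h : BraidRelations T m) {c : ℕ} (hc : c ≤ m) :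
    ((stairList c).map T).prod = ((veeList 0 c).map T).prod := by
  induction c with
  | zero => rfl
  | succ c ih =>
    have hlt : ∀ i ∈ veeList 0 c, i < c := fun i hi => (lt_of_mem_veeList hi).trans_eq (zero_add c)
    rw [stairList, List.map_append, List.prod_append, ih (by omega),
      h.prod_mul_prod_descList (by omega) hlt, map_succ_veeList, veeList, List.map_append,
      List.prod_append]

variable {k : Type*} [Field k] {n : ℕ}

/-- `heckeOp` in the monoid of self-maps of `k(x)`, indexed by all natural numbers; the value at
an index `i ≥ n - 1` is irrelevant. -/
def heckeEnd (n : ℕ) (t : k) (i : ℕ) : Function.End (RatField k n) :=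
  if h : i < n - 1 then heckeOp t ⟨i, h⟩ else 1

theorem heckeEnd_apply (t : k) {i : ℕ} (h : i < n - 1) (f : RatField k n) :
    heckeEnd n t i f = heckeOp t ⟨i, h⟩ f :=
  congrFun (dif_pos h) f

theorem heckeEnd_mul_apply (t : k) {i : ℕ} (h : i < n - 1) (T : Function.End (RatField k n))
    (f : RatField k n) : (heckeEnd n t i * T) f = heckeOp t ⟨i, h⟩ (T f) :=
  heckeEnd_apply t h (T f)

theorem braidRelations_heckeEnd (n : ℕ) (t : k) : BraidRelations (heckeEnd n t) (n - 1) where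
  comm i j hij hj := by
    have hi : i < n - 1 := by omega
    refine funext fun f => ?_
    rw [heckeEnd_mul_apply t hi, heckeEnd_mul_apply t hj, heckeEnd_apply t hi,
      heckeEnd_apply t hj, heckeOp_comm t hij]
  braid i hi := by
    have hi' : i < n - 1 := by omega
    refine funext fun f => ?_
    simp only [mul_assoc, heckeEnd_mul_apply t hi, heckeEnd_mul_apply t hi', heckeEnd_apply t hi,
      heckeEnd_apply t hi']
    exact heckeOp_braid t rfl f

theorem heckeWord_eq_prod (t : k) (L : List (Fin (n - 1))) (f : RatField k n) :
    heckeWord t L f = ((L.map Fin.val).map (heckeEnd n t)).prod f := by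
  induction L with
  | nil => rfl
  | cons i L ih =>
    rw [List.map_cons, List.map_cons, List.prod_cons, heckeEnd_mul_apply t i.isLt, ← ih]
    rfl

theorem heckeWord_reverse_map_rev_longWord (t : k) (f : RatField k n) :
    heckeWord t ((longWord n).map Fin.rev).reverse f = heckeLong t f := by
  rw [heckeLong, heckeWord_eq_prod, heckeWord_eq_prod, map_val_longWord,
    map_val_reverse_map_rev_longWord, (braidRelations_heckeEnd n t).prod_stairList le_rfl]

end BraidMonoid

/-! ### Symmetry of the primed functions -/

section Lattice

variable {k : Type*} [Field k] {q t : k} {n : ℕ}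

/-- The operator through which `heckeOp t⁻¹ i.rev` acts on the values `φ u` of a rational function
at the points `w₀ ū`, up to a common scalar. -/
def latticeOp (q t : k) (i : Fin (n - 1)) (φ : (Fin n → ℤ) → k) (u : Fin n → ℤ) : k :=
  t⁻¹ * φ u + heckeCoeff t⁻¹ (rgt i) (lft i) (bar q t u) * (φ (u ∘ simple i) - φ u)

/-- `latticeOp` acting on the first of two variables. -/
def opLeft (q t : k) (i : Fin (n - 1)) (S : (Fin n → ℤ) → (Fin n → ℤ) → k)
    (u v : Fin n → ℤ) : k :=
  latticeOp q t i (fun u => S u v) u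

/-- `latticeOp` acting on the second of two variables. -/
def opRight (q t : k) (i : Fin (n - 1)) (S : (Fin n → ℤ) → (Fin n → ℤ) → k)
    (u v : Fin n → ℤ) : k :=
  latticeOp q t i (S u) v

variable {S : (Fin n → ℤ) → (Fin n → ℤ) → k}

theorem opRight_opLeft (i j : Fin (n - 1)) (S : (Fin n → ℤ) → (Fin n → ℤ) → k) :
    opRight q t j (opLeft q t i S) = opLeft q t i (opRight q t j S) := by
  ext u v
  simp only [opLeft, opRight, latticeOp]
  ring

theorem opRight_foldr_opLeft (j : Fin (n - 1)) (L : List (Fin (n - 1)))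
    (S : (Fin n → ℤ) → (Fin n → ℤ) → k) :
    opRight q t j (L.foldr (opLeft q t) S) = L.foldr (opLeft q t) (opRight q t j S) := by
  induction L with
  | nil => rfl
  | cons i L ih => rw [List.foldr_cons, opRight_opLeft, ih, List.foldr_cons]

theorem foldr_opRight_rev (hop : ∀ i : Fin (n - 1), opRight q t i.rev S = opLeft q t i S)
    (L : List (Fin (n - 1))) :
    L.foldr (fun i => opRight q t i.rev) S = L.reverse.foldr (opLeft q t) S := by
  induction L with
  | nil => rfl
  | cons i L ih =>
    rw [List.foldr_cons, ih, opRight_foldr_opLeft, hop, List.reverse_cons, List.foldr_append]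
    rfl

theorem foldr_opLeft_swap (hsymm : ∀ u v, S u v = S v u) (L : List (Fin (n - 1)))
    (u v : Fin n → ℤ) : L.foldr (opLeft q t) S u v = L.foldr (opRight q t) S v u := by
  induction L generalizing u v with
  | nil => exact hsymm u v
  | cons i L ih => simp only [List.foldr_cons, opLeft, opRight, latticeOp, ih]

theorem foldr_opRight_rev_symm (hsymm : ∀ u v, S u v = S v u)
    (hop : ∀ i : Fin (n - 1), opRight q t i.rev S = opLeft q t i S) (L : List (Fin (n - 1)))
    (u v : Fin n → ℤ) :
    L.foldr (fun i => opRight q t i.rev) S v u =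
      (L.map Fin.rev).reverse.foldr (fun i => opRight q t i.rev) S u v := by
  rw [foldr_opRight_rev hop, foldr_opLeft_swap hsymm, ← List.map_reverse, List.foldr_map]
  simp only [Fin.rev_rev]

theorem foldr_opRight_apply (S : (Fin n → ℤ) → (Fin n → ℤ) → k) (L : List (Fin (n - 1)))
    (v : Fin n → ℤ) :
    L.foldr (fun i => opRight q t i.rev) S v =
      L.foldr (fun i => latticeOp q t i.rev) (S v) := by
  induction L with
  | nil => rfl
  | cons i L ih =>
    rw [List.foldr_cons, List.foldr_cons, ← ih]
    rfl

/-- `f` is regular at all permutations of the points `b ū`, and its value at `b w₀ ū` is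
`φ u`. -/
structure HasLatticeVal (q t b : k) (f : RatField k n) (φ : (Fin n → ℤ) → k) : Prop where
  regular : ∀ (u : Fin n → ℤ) (w : Equiv.Perm (Fin n)), IsRegularAt f fun i => b * bar q t u (w i)
  hasVal : ∀ u : Fin n → ℤ, HasVal f (fun i => b * bar q t u i.rev) (φ u)

theorem HasVal.heckeOp {f : RatField k n} {y : Fin n → k} {c c' : k} (s : k) (i : Fin (n - 1))
    (h : HasVal f y c) (h' : HasVal f (y ∘ simple i) c') (hy : y (lft i) ≠ y (rgt i)) :
    HasVal (heckeOp s i f) y (s * c + heckeCoeff s (lft i) (rgt i) y * (c' - c)) :=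
  have hnum := (hasVal_var (lft i) y).sub ((hasVal_const s y).mul (hasVal_var (rgt i) y))
  have hden := (hasVal_var (lft i) y).sub (hasVal_var (rgt i) y)
  ((hasVal_const s y).mul h).add
    ((hnum.div hden (sub_ne_zero.2 hy)).mul ((h'.permAct _).sub h))

theorem lft_rev (i : Fin (n - 1)) : lft i.rev = (rgt i).rev := by
  ext
  simp only [lft, rgt, Fin.val_rev]
  omega

theorem rgt_rev (i : Fin (n - 1)) : rgt i.rev = (lft i).rev := by
  ext
  simp only [lft, rgt, Fin.val_rev]
  omega

theorem rev_simple (i : Fin (n - 1)) (l : Fin n) : (simple i l).rev = simple i.rev l.rev := by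
  rw [simple, rev_swap, simple, lft_rev, rgt_rev, Equiv.swap_comm]

theorem heckeCoeff_inv_bar_of_eq (ht : t ≠ 0) {u : Fin n → ℤ} {i j : Fin n}
    (hij : (j : ℕ) = i + 1) (hu : u i = u j) : heckeCoeff t⁻¹ j i (bar q t u) = 0 :=
  heckeCoeff_eq_zero (by rw [bar_of_eq ht u hij hu, inv_mul_cancel_left₀ ht])

variable {b : k} {f : RatField k n} {φ : (Fin n → ℤ) → k}

theorem HasLatticeVal.hasVal_simple (h : HasLatticeVal q t b f φ) {i : Fin (n - 1)}
    {u : Fin n → ℤ} (hu : u (lft i.rev) ≠ u (rgt i.rev)) :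
    HasVal f ((fun l => b * bar q t u l.rev) ∘ simple i) (φ (u ∘ simple i.rev)) := by
  have hbar : bar q t (u ∘ simple i.rev) = bar q t u ∘ simple i.rev := bar_comp_swap u rfl hu
  convert h.hasVal (u ∘ simple i.rev) using 1
  ext l
  rw [hbar, Function.comp_apply, Function.comp_apply, rev_simple]

theorem HasLatticeVal.heckeOp (hg : Generic q t) (hb : b ≠ 0) (h : HasLatticeVal q t b f φ)
    (i : Fin (n - 1)) :
    HasLatticeVal q t b (heckeOp t⁻¹ i f) (latticeOp q t i.rev φ) where
  regular u w := by
    have hne : b * bar q t u (w (lft i)) ≠ b * bar q t u (w (rgt i)) :=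
      (mul_right_injective₀ hb).ne (((hg.bar_injective u).comp w.injective).ne (lft_ne_rgt i))
    obtain ⟨c, hc⟩ := (h.regular u w).hasVal
    obtain ⟨c', hc'⟩ := (h.regular u (w * simple i)).hasVal
    exact (hc.heckeOp t⁻¹ i hc' hne).isRegularAt
  hasVal u := by
    have hne : b * bar q t u (lft i).rev ≠ b * bar q t u (rgt i).rev :=
      (mul_right_injective₀ hb).ne
        (((hg.bar_injective u).comp Fin.rev_injective).ne (lft_ne_rgt i))
    have hcoeff : heckeCoeff t⁻¹ (lft i) (rgt i) (fun l => b * bar q t u l.rev) =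
        heckeCoeff t⁻¹ (rgt i.rev) (lft i.rev) (bar q t u) := by
      rw [heckeCoeff_mul_left _ hb, lft_rev, rgt_rev]
      rfl
    rw [latticeOp]
    by_cases hu : u (lft i.rev) = u (rgt i.rev)
    · obtain ⟨c, hc⟩ := (h.regular u (Fin.revPerm * simple i)).hasVal
      have hval := (h.hasVal u).heckeOp t⁻¹ i hc hne
      rw [hcoeff] at hval
      rwa [heckeCoeff_inv_bar_of_eq hg.t_ne_zero rfl hu, zero_mul] at hval ⊢
    · have hval := (h.hasVal u).heckeOp t⁻¹ i (h.hasVal_simple hu) hne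
      rwa [hcoeff] at hval

theorem HasLatticeVal.heckeWord (hg : Generic q t) (hb : b ≠ 0) (h : HasLatticeVal q t b f φ)
    (L : List (Fin (n - 1))) :
    HasLatticeVal q t b (heckeWord t⁻¹ L f) (L.foldr (fun i => latticeOp q t i.rev) φ) := by
  induction L with
  | nil => exact h
  | cons i L ih => exact ih.heckeOp hg hb i

theorem HasLatticeVal.hasVal_permAct_w0 (h : HasLatticeVal q t b f φ) (u : Fin n → ℤ) :
    HasVal (permAct (w0 n) f) (fun i => b * bar q t u i) (φ u) :=
  HasVal.permAct (w0 n) (h.hasVal u)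

theorem HasLatticeVal.foldr_longWord (hg : Generic q t) (hb : b ≠ 0)
    (h : HasLatticeVal q t b f φ) :
    (longWord n).foldr (fun i => latticeOp q t i.rev) φ =
      ((longWord n).map Fin.rev).reverse.foldr (fun i => latticeOp q t i.rev) φ := by
  ext u
  have hval := (h.heckeWord hg hb ((longWord n).map Fin.rev).reverse).hasVal u
  rw [heckeWord_reverse_map_rev_longWord] at hval
  exact ((h.heckeWord hg hb (longWord n)).hasVal u).value_eq.symm.trans hval.value_eq

theorem map_bar {σ : k →+* k} (hσq : σ q = q⁻¹) (hσt : σ t = t⁻¹) (u : Fin n → ℤ) (i : Fin n) :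
    σ (bar q t u i) = (bar q t u i)⁻¹ := by
  rw [bar, map_mul, map_zpow₀, map_zpow₀, hσq, hσt, inv_zpow, inv_zpow, mul_inv]

theorem map_heckeCoeff_bar (hq : q ≠ 0) (ht : t ≠ 0) {σ : k →+* k} (hσq : σ q = q⁻¹)
    (hσt : σ t = t⁻¹) (u : Fin n → ℤ) (i j : Fin n) :
    σ (heckeCoeff t i j (bar q t u)) = heckeCoeff t⁻¹ j i (bar q t u) := by
  rw [← heckeCoeff_inv t⁻¹ (bar_ne_zero hq ht u i) (bar_ne_zero hq ht u j)]
  simp only [heckeCoeff, map_div₀, map_sub, map_mul, map_bar hσq hσt, hσt]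

end Lattice

section Primed

variable {k : Type*} [Field k] {N : ℕ}

theorem numer_toNat {q : k} (hq : q ≠ 0) (t a : k) {n m : ℕ} {v : Fin n → ℤ}
    (hm : ∀ i, 0 ≤ v i + m) :
    numer q t a m (fun i => ((v i + m).toNat : ℤ)) =
      ∏ i, qPoch q (q ^ (1 - (m : ℤ)) * a * (bar q t v i)⁻¹) m := by
  have hbar : (bar q t fun i => ((v i + m).toNat : ℤ)) = fun i => q ^ m * bar q t v i :=
    node_toNat hq hm
  refine Finset.prod_congr rfl fun i _ => congrArg (qPoch q · m) ?_
  rw [hbar, mul_inv, zpow_sub₀ hq, zpow_one, zpow_natCast, div_eq_mul_inv]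
  ring

theorem hasVal_prod_div_qPoch {q t : k} (c : Fin (N + 1) → k) (m : ℕ) {y : Fin (N + 1) → k}
    (hy : GenericPoint q t y) :
    HasVal (∏ i, algebraMap k (RatField k (N + 1)) (c i) /
        qPoch (algebraMap k (RatField k (N + 1)) q)
          (algebraMap k (RatField k (N + 1)) (q * t ^ (((N + 1 : ℕ) : ℤ) - 1)) * var i) m) y
      ((∏ i, c i) / denom q t m y) := by
  have hpow : t ^ (((N + 1 : ℕ) : ℤ) - 1) = t ^ N := by
    rw [Nat.cast_succ, add_sub_cancel_right, zpow_natCast]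
  have hden := Finset.prod_ne_zero_iff.1 (denom_ne_zero hy m)
  simp only [← mul_assoc] at hden
  simp only [denom, ← mul_assoc, hpow]
  rw [← Finset.prod_div_distrib]
  exact HasVal.prod _ fun i hi =>
    (hasVal_const (c i) y).div (hasVal_qPoch q _ i m y) (hden i hi)

theorem GenericPoint.comp_perm {q t : k} {y : Fin (N + 1) → k} (hy : GenericPoint q t y)
    (w : Equiv.Perm (Fin (N + 1))) : GenericPoint q t (y ∘ w) :=
  fun i => hy (w i)

theorem map_dualPoint {q t a : k} (ht : t ≠ 0) {σ : k →+* k} (hσq : σ q = q⁻¹)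
    (hσt : σ t = t⁻¹) (hσa : σ a = a⁻¹) {n : ℕ} (u : Fin n → ℤ) (i : Fin n) :
    σ (dualPoint q t a u i) = t ^ ((n : ℤ) - 1) * (a⁻¹ * bar q t u i.rev) := by
  unfold dualPoint negRev
  rw [bar_neg_rev ht, map_mul, map_mul, map_zpow₀, map_inv₀, map_bar hσq hσt, hσa, hσt, inv_inv,
    inv_zpow, ← zpow_neg, neg_sub, mul_left_comm]

theorem GenericParams.hasLatticeVal {q t a : kˣ} (h : GenericParams (q : k) t a) {σ : k →+* k}
    (hσq : σ q = (q : k)⁻¹) (hσt : σ t = (t : k)⁻¹) (hσa : σ a = (a : k)⁻¹)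
    {f : RatField k (N + 1)} {φ : (Fin (N + 1) → k) → k}
    (hf : ∀ y, GenericPoint (q : k) t y → HasVal f y (φ y)) :
    HasLatticeVal (q : k) t (a : k)⁻¹ (scale (t ^ (((N + 1 : ℕ) : ℤ) - 1)) (coeffAct σ f))
      fun u => σ (φ (dualPoint (q : k) t a u)) := by
  have hpoint (u : Fin (N + 1) → ℤ) (w : Equiv.Perm (Fin (N + 1))) :
      (fun i => ((t ^ (((N + 1 : ℕ) : ℤ) - 1) : kˣ) : k) *
        ((a : k)⁻¹ * bar (q : k) t u (w i).rev)) = σ ∘ (dualPoint (q : k) t a u ∘ w) := by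
    ext i
    rw [Units.val_zpow_eq_zpow_val]
    exact (map_dualPoint t.ne_zero hσq hσt hσa u (w i)).symm
  have hval (u : Fin (N + 1) → ℤ) (w : Equiv.Perm (Fin (N + 1))) :
      HasVal (scale (t ^ (((N + 1 : ℕ) : ℤ) - 1)) (coeffAct σ f))
        (fun i => (a : k)⁻¹ * bar (q : k) t u (w i).rev)
        (σ (φ (dualPoint (q : k) t a u ∘ w))) := by
    have hcirc := (hf _ ((h.genericPoint_mul_bar (negRev u)).comp_perm w)).coeffAct σ
    refine HasVal.scale _ ?_
    rw [hpoint]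
    exact hcirc
  refine ⟨fun u w => ?_, fun u => hval u 1⟩
  have hreg := (hval u (Fin.revPerm * w)).isRegularAt
  simp only [Equiv.Perm.mul_apply, Fin.revPerm_apply, Fin.rev_rev] at hreg
  exact hreg

/-- The values `ι(K_v(aũ))` of `K_v°(t^{n-1} x)` at the points `a⁻¹ w₀ ū`, where `σ` plays the
role of `ι`. -/
def dualValue (σ : k →+* k) (q t a : k) (v u : Fin (N + 1) → ℤ) : k :=
  σ (Kval q t a v (dualPoint q t a u))

/-- The value of `K'_v` at `a⁻¹ ū`, up to the factor `t^{ℓ(w₀)}`. -/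
def primeValue (σ : k →+* k) (q t a : k) : (Fin (N + 1) → ℤ) → (Fin (N + 1) → ℤ) → k :=
  (longWord (N + 1)).foldr (fun i => opRight q t i.rev) (dualValue σ q t a)

theorem GenericParams.opRight_rev_dualValue {q t a : k} (h : GenericParams q t a) {σ : k →+* k}
    (hσq : σ q = q⁻¹) (hσt : σ t = t⁻¹) (i : Fin (N + 1 - 1)) :
    opRight q t i.rev (dualValue σ q t a) = opLeft q t i (dualValue σ q t a) := by
  ext u v
  have hrec := congrArg σ (h.Kval_dualPoint_hecke u v (i := lft i) (j := rgt i) rfl)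
  simp only [map_mul, map_sub,
    map_heckeCoeff_bar h.generic.q_ne_zero h.generic.t_ne_zero hσq hσt, ← lft_rev,
    ← rgt_rev] at hrec
  exact congrArg (t⁻¹ * dualValue σ q t a u v + ·) hrec

theorem GenericParams.hasVal_permAct_heckeLong {q t a : kˣ} (h : GenericParams (q : k) t a)
    {σ : k →+* k} (hσq : σ q = (q : k)⁻¹) (hσt : σ t = (t : k)⁻¹) (hσa : σ a = (a : k)⁻¹)
    {f : RatField k (N + 1)} {v : Fin (N + 1) → ℤ}
    (hf : ∀ y, GenericPoint (q : k) t y → HasVal f y (Kval (q : k) t a v y))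
    (u : Fin (N + 1) → ℤ) :
    HasVal (permAct (w0 (N + 1))
        (heckeLong (t : k)⁻¹ (scale (t ^ (((N + 1 : ℕ) : ℤ) - 1)) (coeffAct σ f))))
      (fun i => (a : k)⁻¹ * bar (q : k) t u i) (primeValue σ (q : k) t a v u) := by
  have hlong := (h.hasLatticeVal hσq hσt hσa hf).heckeWord h.generic
    (inv_ne_zero h.a_ne_zero) (longWord (N + 1))
  rw [primeValue, foldr_opRight_apply]
  exact hlong.hasVal_permAct_w0 u

theorem GenericParams.primeValue_symm {q t a : kˣ} (h : GenericParams (q : k) t a)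
    {σ : k →+* k} (hσq : σ q = (q : k)⁻¹) (hσt : σ t = (t : k)⁻¹) (hσa : σ a = (a : k)⁻¹)
    {f : (Fin (N + 1) → ℤ) → RatField k (N + 1)}
    (hf : ∀ v y, GenericPoint (q : k) t y → HasVal (f v) y (Kval (q : k) t a v y))
    (u v : Fin (N + 1) → ℤ) :
    primeValue σ (q : k) t a u v = primeValue σ (q : k) t a v u := by
  have hsymm (u v : Fin (N + 1) → ℤ) :
      dualValue σ (q : k) t a u v = dualValue σ (q : k) t a v u :=
    congrArg σ (h.Kval_dualPoint_symm u v)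
  have hword := (h.hasLatticeVal hσq hσt hσa (hf v)).foldr_longWord h.generic
    (inv_ne_zero h.a_ne_zero)
  rw [primeValue, foldr_opRight_rev_symm hsymm (h.opRight_rev_dualValue hσq hσt),
    foldr_opRight_apply, foldr_opRight_apply]
  exact congrFun hword.symm u

theorem a_mul_ne_one (i j : ℤ) : (a : KK) * ((q : KK) ^ i * (t : KK) ^ j) ≠ 1 := by
  intro h
  have hqt : (q : KK) ^ i * (t : KK) ^ j = algebraMap FF KK (qF ^ i * tF ^ j) := by
    rw [map_mul, map_zpow₀, map_zpow₀]
    rfl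
  have ha : (RatFunc.X : KK) = algebraMap FF KK (qF ^ i * tF ^ j)⁻¹ := by
    rw [map_inv₀, ← hqt]
    exact eq_inv_of_mul_eq_one_left h
  exact RatFunc.transcendental_X (K := FF) (ha ▸ isAlgebraic_algebraMap _)

theorem genericParams_KK : GenericParams (q : KK) (t : KK) (a : KK) :=
  ⟨generic_KK, a.ne_zero, a_mul_ne_one⟩

theorem eval_Kpol (α : Fin (N + 1) → ℕ) (y : Fin (N + 1) → KK) :
    eval y (Kpol α) = Kcomp (q : KK) t a α y := by
  rw [Kpol, GK_eq_interp, C_mul', smul_eval]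
  rfl

theorem hasVal_K (v : Fin (N + 1) → ℤ) (y : Fin (N + 1) → KK)
    (hy : GenericPoint (q : KK) t y) : HasVal (K v) y (Kval (q : KK) t a v y) := by
  have hA := hasVal_prod_div_qPoch
    (fun i => qPoch (q : KK) ((q : KK) ^ (1 - (shift v : ℤ)) * a * (bar (q : KK) t v i)⁻¹)
      (shift v)) (shift v) hy
  have hK := (hasVal_algebraMap (Kpol fun i => (v i + shift v).toNat) _).scale (q ^ shift v)
    (y := y)
  rw [← numer_toNat q.ne_zero _ _ (shift_nonneg v)] at hA
  rw [eval_Kpol] at hK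
  exact hA.mul hK

theorem hasVal_Kprime (v u : Fin (N + 1) → ℤ) :
    HasVal (Kprime v) (ainvBar u)
      ((t : KK) ^ len (w0 (N + 1)) * primeValue iota (q : KK) t a v u) :=
  (hasVal_const _ _).mul
    (genericParams_KK.hasVal_permAct_heckeLong iota_q iota_t iota_a (hasVal_K v) u)

theorem primeValue_iota_symm (u v : Fin (N + 1) → ℤ) :
    primeValue iota (q : KK) t a u v = primeValue iota (q : KK) t a v u :=
  genericParams_KK.primeValue_symm iota_q iota_t iota_a hasVal_K u v

theorem isRegularAt_zero_vars {k : Type*} [Field k] (f : RatField k 0) (y : Fin 0 → k) :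
    IsRegularAt f y := by
  obtain ⟨p, d, hd, rfl⟩ := IsFractionRing.div_surjective (A := MvPolynomial (Fin 0) k) f
  refine ⟨p, d, fun hzero => nonZeroDivisors.ne_zero hd ?_, rfl⟩
  rw [eq_C_of_isEmpty d] at hzero ⊢
  rw [eval_C] at hzero
  rw [hzero, C_0]

end Primed

end InterpMacdonald

end

theorem mainTheorem6 {n : ℕ} (u v : Fin n → ℤ) :
    InterpMacdonald.IsRegularAt (InterpMacdonald.Kprime v) (InterpMacdonald.ainvBar u) ∧
    InterpMacdonald.IsRegularAt (InterpMacdonald.Kprime u) (InterpMacdonald.ainvBar v) ∧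
    InterpMacdonald.value (InterpMacdonald.Kprime v) (InterpMacdonald.ainvBar u) =
      InterpMacdonald.value (InterpMacdonald.Kprime u) (InterpMacdonald.ainvBar v) := by
  rcases n with _ | N
  · exact ⟨InterpMacdonald.isRegularAt_zero_vars _ _, InterpMacdonald.isRegularAt_zero_vars _ _,
      by rw [Subsingleton.elim u v]⟩
  · have hvu := InterpMacdonald.hasVal_Kprime v u
    have huv := InterpMacdonald.hasVal_Kprime u v
    exact ⟨hvu.isRegularAt, huv.isRegularAt, by
      rw [hvu.value_eq, huv.value_eq, InterpMacdonald.primeValue_iota_symm]⟩
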